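/- Let $\mathcal G_1,\dots,\mathcal G_M\subseteq\{1,\dots,N\}$ ($M\ge 1$) be groups covering $\{1,\dots,N\}$ that are loopless pairwise overlapping: every element lies in at most two groups, and the group graph, in which two distinct groups are adjacent when they intersect, is a forest. Let $x\in\mathbb R^N$, let $G,K\ge 1$ be integers, and let $A\in\{0,1\}^{N\times M}$ be the matrix with $A_{ij}=1$ iff $i\in\mathcal G_j$. Consider weighted maximum coverage with group budget $G$ and element-sparsity budget $K$: $$\max_{\omega\in\{0,1\}^M,\ y\in\{0,1\}^N}\Big\{\sum_{i=1}^N y_i x_i^2 \;:\; A\omega\ge y,\ \sum_{i=1}^N y_i\le K,\ \sum_{j=1}^M\omega_j\le G\Big\}.$$ The dynamic program is as follows. *Node picking.* Root every tree of the forest at an arbitrary node. For a node with subtrees $T_1,\dots,T_R$ whose $D$-values are sorted as $D_1\ge\dots\ge D_R$, put $D=\max(D_1,D_2+1)$ (missing subtrees count as $0$) and explore, recursively, in the order $T_1$, the node, $T_2,\dots,T_R$. The trees are explored one after the other. A boundary node is an explored node that is adjacent to an unexplored one. *Value update.* For the set of explored nodes, all $1\le g\le G$, $1\le k\le K$ and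 every assignment of $0$ (forbidden) or $1$ (selected) to the boundary nodes, a table stores a value for at most $k$ elements from at most $g$ explored groups, with a selection attaining it. All values are $0$ at the start and for $g=0$ or $k=0$. When a node is explored, it is either rejected, which leaves the values unchanged, or accepted, with the value $\max_{1\le\ell\le k}\{F(g-1,k-\ell)+H(\mathcal X',\ell)\}$, where $F$ is the table before the step (for the same assignment of the boundary nodes), $\mathcal X'$ is the new group without the elements of the boundary groups assigned $1$, and $H(\mathcal X',\ell)$ is the sum of the $\ell$ largest weights $x_i^2$ in $\mathcal X'$ (of all of them if there are fewer than $\ell$). Then, for each node that is no longer a boundary node, the values for $0$ and $1$ are merged by taking the larger one. The result is the entry for $(G,K)$ after all nodes have been explored. **Theorem.** For every choice of the roots: 1. The node picking order lists every node exactly once, and at every step it has at most $\log_2(M)+1$ boundary nodes. 2. The dynamic program returns the optimal value of the problem together with an optimal solution $(\omega,y)$. 3. Its running time, including the computation of the node order, is $O(M^2GK^2)$ with an absolute constant. Here each of the following is one step: an arithmetic operation or comparison, an access to a table entry, a test whether two given groups overlap, and cleaning a group together with looking up $H(\mathcal X',\ell)$ and its elements. 4. It runs in polynomial time also if overlap tests,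 cleaning and $H$ are charged at the cost of explicit elementary subroutines (scanning the ground set, insertion sort): the number of steps is then $O\big(M^2GK^2\,(M+N+1)^2\big)$ with an absolute constant. -/

import Mathlib

/-! ## Step counting

A program is written in the monad `Timed`: it returns a value together with the number of steps
that it has taken. Binding adds the steps, and every step is charged by an explicit `tick`. -/

/-- A value together with the number of steps used to compute it. -/
structure Timed (α : Type) where
  ret : α
  time : ℕ

namespace Timed

instance : Monad Timed where
  pure a := ⟨a, 0⟩
  bind t f := ⟨(f t.ret).ret, t.time + (f t.ret).time⟩

/-- Take `n` steps. -/
def tick (n : ℕ) : Timed Unit := ⟨(), n⟩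

/-- Loop over a list, one step of overhead per item. -/
def foldl {α σ : Type} (f : σ → α → Timed σ) : σ → List α → Timed σ
  | s, [] => pure s
  | s, a :: l => do
    tick 1
    let t ← f s a
    foldl f t l

/-- Apply a program to every item of a list, one step of overhead per item. -/
def map {α β : Type} (f : α → Timed β) : List α → Timed (List β)
  | [] => pure []
  | a :: l => do
    tick 1
    let b ← f a
    let r ← map f l
    pure (b :: r)

/-- Keep the items of a list that pass a test, one step of overhead per item. -/
def filter {α : Type} (p : α → Timed Bool) : List α → Timed (List α)
  | [] => pure []
  | a :: l => do
    tick 1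
    let b ← p a
    let r ← filter p l
    pure (if b then a :: r else r)

/-- Insert an item into a list that is sorted by decreasing `key`, one step per comparison. -/
noncomputable def insertDesc {α κ : Type} [LinearOrder κ] (key : α → κ) (a : α) :
    List α → Timed (List α)
  | [] => do
    tick 1
    pure [a]
  | b :: l => do
    tick 1
    if key b ≤ key a then
      pure (a :: b :: l)
    else do
      let r ← insertDesc key a l
      pure (b :: r)

/-- Insertion sort by decreasing `key`. -/
noncomputable def sortDesc {α κ : Type} [LinearOrder κ] (key : α → κ) : List α → Timed (List α)
  | [] => pure []
  | a :: l => do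
    let s ← sortDesc key l
    insertDesc key a s

end Timed

/-- How the operations on the groups themselves (testing whether two groups overlap; cleaning a
group and looking up its heaviest elements) are charged: as one step each, or at the cost of the
explicit subroutines given below. -/
inductive CostModel
  | unit
  | elementary

/-- Run a subroutine and charge it according to the cost model. -/
def CostModel.charge {α : Type} : CostModel → Timed α → Timed α
  | .unit, t => ⟨t.ret, 1⟩
  | .elementary, t => t

/-! ## Group structures and the optimization problem -/

/-- A group structure: `M` groups that cover the ground set of `N` elements. -/
structure GroupStructure (N M : ℕ) where
  group : Fin M → Finset (Fin N)
  covers : ∀ i, ∃ j, i ∈ group j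

/-- The entries of a table of the dynamic program: a value, and a selection of groups and of
elements that attains it. The elements are kept in batches, one batch for every group, so that
extending a selection by a group takes one step. -/
structure Entry (N M : ℕ) where
  val : ℝ
  groups : List (Fin M)
  batches : List (List (Fin N))

/-- The output of the dynamic program: the value, the chosen groups and the chosen elements. -/
structure Selection (N M : ℕ) where
  val : ℝ
  groups : List (Fin M)
  elems : List (Fin N)

/-- The binary vector of the members of a list. -/
def listIndicator {n : ℕ} (l : List (Fin n)) : Fin n → Fin 2 := fun i => if i ∈ l then 1 else 0

/-- An assignment of the three-valued indicator variables, one for each group: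
`1` is selected, `0` is forbidden, `2` is no restriction. -/
abbrev Assignment (M : ℕ) := Fin M → Fin 3

/-- The table `F(S, g, k, I)` for a fixed set `S` of explored nodes. -/
abbrev Table (N M : ℕ) := Assignment M → ℕ → ℕ → Entry N M

namespace GroupStructure

open Timed

variable {N M : ℕ}

/-- The group graph: two distinct groups are adjacent when they overlap. -/
def groupGraph (𝔊 : GroupStructure N M) : SimpleGraph (Fin M) where
  Adj i j := i ≠ j ∧ (𝔊.group i ∩ 𝔊.group j).Nonempty
  symm := ⟨fun i j h => ⟨h.1.symm, by rw [Finset.inter_comm]; exact h.2⟩⟩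
  loopless := ⟨fun _ h => h.1 rfl⟩

/-- Every element lies in at most two groups, and the group graph is a forest. -/
def LooplessPairwiseOverlapping (𝔊 : GroupStructure N M) : Prop :=
  (∀ i : Fin N, (Finset.univ.filter fun j => i ∈ 𝔊.group j).card ≤ 2) ∧ 𝔊.groupGraph.IsAcyclic

open Classical in
/-- The boundary nodes of a set of explored nodes: the explored nodes that are adjacent to an
unexplored node. -/
noncomputable def boundary (𝔊 : GroupStructure N M) (S : Finset (Fin M)) : Finset (Fin M) :=
  S.filter fun v => ∃ u, u ∉ S ∧ 𝔊.groupGraph.Adj v u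

/-- The bi-adjacency matrix of elements and groups. -/
def biadjacency (𝔊 : GroupStructure N M) : Matrix (Fin N) (Fin M) ℕ :=
  Matrix.of fun i j => if i ∈ 𝔊.group j then 1 else 0

/-- The constraints of weighted maximum coverage with group budget `G` and sparsity budget `K`. -/
structure Feasible (𝔊 : GroupStructure N M) (G K : ℕ) (ω : Fin M → Fin 2) (y : Fin N → Fin 2) :
    Prop where
  covered : ∀ i, (y i : ℕ) ≤ (𝔊.biadjacency.mulVec fun j => (ω j : ℕ)) i
  sparse : ∑ i, (y i : ℕ) ≤ K
  groupSparse : ∑ j, (ω j : ℕ) ≤ G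

/-- The objective `∑ yᵢ xᵢ²`. -/
noncomputable def objective (x : Fin N → ℝ) (y : Fin N → Fin 2) : ℝ :=
  ∑ i, ((y i : ℕ) : ℝ) * x i ^ 2

/-- `(ω, y)` is a solution of weighted maximum coverage with the two budgets. -/
def IsOptimal (𝔊 : GroupStructure N M) (x : Fin N → ℝ) (G K : ℕ) (ω : Fin M → Fin 2)
    (y : Fin N → Fin 2) : Prop :=
  𝔊.Feasible G K ω y ∧ ∀ ω₁ y₁, 𝔊.Feasible G K ω₁ y₁ → objective x y₁ ≤ objective x y

/-! ## Subroutines on the groups -/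

/-- Test whether two groups are adjacent, by scanning the ground set. -/
def adjacent (𝔊 : GroupStructure N M) (i j : Fin M) : Timed Bool := do
  tick (N + 1)
  pure (decide (i ≠ j ∧ (𝔊.group i ∩ 𝔊.group j).Nonempty))

/-- The elements of the group `v` that lie in none of the groups of the list `B` that are selected
by `I`, by testing every element of the ground set against `v` and the groups of `B`. -/
def cleaned (𝔊 : GroupStructure N M) (B : List (Fin M)) (I : Assignment M) (v : Fin M) :
    Timed (List (Fin N)) :=
  Timed.filter (fun i => do
    tick (B.length + 1)
    pure (decide (i ∈ 𝔊.group v ∧ ∀ j ∈ B, I j = 1 → i ∉ 𝔊.group j))) (List.finRange N)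

/-- `H(X, l)` for the cleaned group `X`: the sum of the `l` largest weights in `X` (of all of them
if there are fewer), with the elements that attain it. -/
noncomputable def heaviest (𝔊 : GroupStructure N M) (x : Fin N → ℝ) (B : List (Fin M))
    (I : Assignment M) (v : Fin M) (l : ℕ) : Timed (ℝ × List (Fin N)) := do
  let X ← 𝔊.cleaned B I v
  let s ← sortDesc (fun i => x i ^ 2) X
  tick ((s.take l).length + 1)
  pure (((s.take l).map fun i => x i ^ 2).sum, s.take l)

/-! ## The node picking rule -/

/-- Explore the subtree below `v`, where `p` is the parent of `v`, if it has one, and the first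
argument bounds the depth. Returns the `D`-value of the subtree and the order in which its nodes
are picked: the subtrees at `v` are sorted so that `D₁ ≥ ⋯ ≥ D_R`, the order is
`T₁, v, T₂, …, T_R`, and `D = max (D₁, D₂ + 1)`, where missing subtrees count as `0`.
Concatenating the orders is charged by the length of the result. -/
noncomputable def pick (𝔊 : GroupStructure N M) (c : CostModel) :
    ℕ → Option (Fin M) → Fin M → Timed (ℕ × List (Fin M))
  | 0, _, v => pure (1, [v])
  | n + 1, p, v => do
    let children ← Timed.filter (fun u => do
      let b ← c.charge (𝔊.adjacent v u)
      pure (b && decide (p ≠ some u))) (List.finRange M)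
    let subtrees ← Timed.map (fun u => 𝔊.pick c n (some v) u) children
    let sorted ← sortDesc Prod.fst subtrees
    let D₁ := (sorted.map Prod.fst).getD 0 0
    let D₂ := (sorted.map Prod.fst).getD 1 0
    let order := ((sorted.take 1).map Prod.snd).flatten ++
      v :: ((sorted.drop 1).map Prod.snd).flatten
    tick order.length
    pure (max D₁ (D₂ + 1), order)

/-- The order in which all nodes are explored. The trees of the forest are explored one after the
other. The roots are arbitrary: the candidates are tried in the order given by `root`. -/
noncomputable def nodeOrder (𝔊 : GroupStructure N M) (c : CostModel)
    (root : Equiv.Perm (Fin M)) : Timed (List (Fin M)) :=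
  Timed.foldl (fun acc v => do
    tick acc.length
    if v ∈ acc then
      pure acc
    else do
      let t ← 𝔊.pick c M none v
      tick (acc.length + t.2.length)
      pure (acc ++ t.2)) [] ((List.finRange M).map root)

/-! ## The value update rule -/

/-- The empty selection. -/
def emptyEntry : Entry N M := ⟨0, [], []⟩

/-- The better one of two entries. -/
noncomputable def better (a b : Entry N M) : Timed (Entry N M) := do
  tick 1
  pure (if a.val < b.val then b else a)

/-- The assignments with values in `{0, 1}` on the nodes of the list and the value `2` elsewhere. -/
def assignments : List (Fin M) → List (Assignment M)
  | [] => [fun _ => 2]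
  | b :: B => (assignments B).flatMap fun I => [Function.update I b 0, Function.update I b 1]

/-- Read an entry. Only the entries with `g, k ≥ 1` are stored, the others are empty selections. -/
def readEntry (F : Table N M) (I : Assignment M) (g k : ℕ) : Timed (Entry N M) := do
  tick 1
  pure (if g = 0 ∨ k = 0 then emptyEntry else F I g k)

/-- Write an entry. -/
def writeEntry (F : Table N M) (I : Assignment M) (g k : ℕ) (e : Entry N M) :
    Timed (Table N M) := do
  tick 1
  pure (Function.update F I (Function.update (F I) g (Function.update (F I g) k e)))

/-- Compute and store the entries for `1 ≤ g ≤ G`, `1 ≤ k ≤ K` and all assignments on the nodes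
of `B`. -/
def fillTable (G K : ℕ) (B : List (Fin M))
    (f : Assignment M → ℕ → ℕ → Timed (Entry N M)) : Timed (Table N M) :=
  Timed.foldl (fun F I =>
    Timed.foldl (fun F g =>
      Timed.foldl (fun F k => do
        let e ← f I g k
        writeEntry F I g k e) F (List.range' 1 K)) F (List.range' 1 G))
    (fun _ _ _ => emptyEntry) (assignments B)

/-- The candidate entry in which the new node `v` is accepted and contributes `l` elements: an
optimal selection of `k - l` elements from `g - 1` explored groups, and the `l` heaviest elements
of `v` outside the selected boundary nodes. -/
noncomputable def candidate (𝔊 : GroupStructure N M) (c : CostModel) (x : Fin N → ℝ)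
    (B : List (Fin M)) (F : Table N M) (v : Fin M) (I : Assignment M) (g k l : ℕ) :
    Timed (Entry N M) := do
  let e ← readEntry F I (g - 1) (k - l)
  let h ← c.charge (𝔊.heaviest x B I v l)
  tick 1
  pure ⟨e.val + h.1, v :: e.groups, h.2 :: e.batches⟩

/-- The new node `v` is accepted: the best candidate over `1 ≤ l ≤ k`. -/
noncomputable def accept (𝔊 : GroupStructure N M) (c : CostModel) (x : Fin N → ℝ)
    (B : List (Fin M)) (F : Table N M) (v : Fin M) (I : Assignment M) (g k : ℕ) :
    Timed (Entry N M) := do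
  let e ← 𝔊.candidate c x B F v I g k 1
  Timed.foldl (fun a l => do
    let b ← 𝔊.candidate c x B F v I g k l
    better a b) e (List.range' 2 (k - 1))

/-- The table after the new node `v` has been rejected (`0`) or accepted (`1`), with separate
entries for `v` and for all boundary nodes of the list `B`. -/
noncomputable def extend (𝔊 : GroupStructure N M) (c : CostModel) (x : Fin N → ℝ) (G K : ℕ)
    (B : List (Fin M)) (F : Table N M) (v : Fin M) : Timed (Table N M) :=
  fillTable G K (v :: B) fun J g k =>
    if J v = 0 then readEntry F (Function.update J v 2) g k
    else 𝔊.accept c x B F v (Function.update J v 2) g k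

/-- Condensation: the node `j` has fallen into the interior of the explored nodes, and its two
values are combined. -/
noncomputable def condense (G K : ℕ) (s : List (Fin M) × Table N M) (j : Fin M) :
    Timed (List (Fin M) × Table N M) := do
  tick s.1.length
  let F ← fillTable G K (s.1.erase j) fun I g k => do
    let a ← readEntry s.2 (Function.update I j 0) g k
    let b ← readEntry s.2 (Function.update I j 1) g k
    better a b
  pure (s.1.erase j, F)

end GroupStructure

/-- The state of the dynamic program: for every node the number of its unexplored neighbours, the
list of the boundary nodes, and the table of the explored nodes. -/
structure DPState (N M : ℕ) where
  unexplored : Fin M → ℕ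
  bdry : List (Fin M)
  table : Table N M

namespace GroupStructure

open Timed

variable {N M : ℕ}

/-- The initial state: nothing is explored, and all values are `0`. -/
def initialState (𝔊 : GroupStructure N M) (c : CostModel) (G K : ℕ) : Timed (DPState N M) := do
  let r ← Timed.foldl (fun r v =>
    Timed.foldl (fun r u => do
      let b ← c.charge (𝔊.adjacent v u)
      pure (if b then Function.update r u (r u + 1) else r)) r (List.finRange M))
    (fun _ => 0) (List.finRange M)
  let F ← fillTable G K [] fun _ _ _ => pure emptyEntry
  pure ⟨r, [], F⟩

/-- Explore the node `v`. -/
noncomputable def explore (𝔊 : GroupStructure N M) (c : CostModel) (x : Fin N → ℝ) (G K : ℕ)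
    (s : DPState N M) (v : Fin M) : Timed (DPState N M) := do
  let r ← Timed.foldl (fun r u => do
    let b ← c.charge (𝔊.adjacent v u)
    pure (if b then Function.update r u (r u - 1) else r)) s.unexplored (List.finRange M)
  let F ← 𝔊.extend c x G K s.bdry s.table v
  let interior ← Timed.filter (fun j => pure (decide (r j = 0))) (v :: s.bdry)
  let t ← Timed.foldl (condense G K) (v :: s.bdry, F) interior
  pure ⟨r, t.1, t.2⟩

/-- The dynamic program: order the nodes by the node picking rule, explore them in this order, and
read off the entry for the budgets `G` and `K` without restrictions on any group. -/
noncomputable def dynamicProgram (𝔊 : GroupStructure N M) (c : CostModel) (x : Fin N → ℝ)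
    (G K : ℕ) (root : Equiv.Perm (Fin M)) : Timed (Selection N M) := do
  let order ← 𝔊.nodeOrder c root
  let s₀ ← 𝔊.initialState c G K
  let s ← Timed.foldl (𝔊.explore c x G K) s₀ order
  let e ← readEntry s.table (fun _ => 2) G K
  tick (e.groups.length + e.batches.length + e.batches.flatten.length)
  pure ⟨e.val, e.groups, e.batches.flatten⟩

end GroupStructure

/-! ### Results and running times of the timed loops -/

namespace Timed

/-! Boundary size. Along the order `T₁, v, T₂, …, T_R`, until `v` is explored only `T₁` contributes
boundary nodes, at most `D₁`. Once `v` is explored, a completed subtree has no unexplored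
neighbours, so only `v` and the subtree in progress contribute, at most `D₂ + 1`. The maximum is the
`D`-value. It is logarithmic in the size: if it equals `D₂ + 1`, the first two subtrees have at
least `2 ^ D₂ - 1` nodes each, and with `v` this makes `2 ^ D - 1`. Hence `2 ^ b ≤ M + 1` for the
number `b` of boundary nodes at any step (`Explores.node`, `pick_spec`, `nodeOrder_spec`).

Optimality. The invariant `IsBest` is asymmetric. An entry has to be a genuine selection that avoids
forbidden groups, but it need not contain the groups assigned `1`. It has to beat only the
competitors: they contain all groups assigned `1`, and each of their groups has a private element.
When `v` is accepted, every explored group meeting `v` is a boundary group, so it can be used only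
if it is assigned `1`; cleaning then prevents double counting (`isSelection_candidate`). Conversely,
deleting `v` from a competitor splits its elements into those that only `v` covers, a nonempty part
of the cleaned group, and the rest, which belong to a competitor for the old table
(`exists_candidate_ge`). Competitors suffice, because a minimal subcover of any feasible selection
gives every group a private element (`Feasible.exists_isCompetitor`).

Running time. There are at most `2 ^ (b + 1) ≤ 4 * M` assignments, so filling a table costs a
multiple of `M * G * K ^ 2`. One exploration may condense many nodes, but each condensation removes
a boundary node and each exploration adds at most one; the length of the boundary list serves as
potential (`explore_spec`). -/

@[simp] theorem ret_pure {α : Type} (a : α) : (pure a : Timed α).ret = a := rfl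

@[simp] theorem time_pure {α : Type} (a : α) : (pure a : Timed α).time = 0 := rfl

@[simp] theorem ret_bind {α β : Type} (t : Timed α) (f : α → Timed β) :
    (t >>= f).ret = (f t.ret).ret := rfl

@[simp] theorem time_bind {α β : Type} (t : Timed α) (f : α → Timed β) :
    (t >>= f).time = t.time + (f t.ret).time := rfl

@[simp] theorem time_tick (n : ℕ) : (tick n).time = n := rfl

theorem ret_foldl {α σ : Type} (f : σ → α → Timed σ) (s : σ) (l : List α) :
    (foldl f s l).ret = l.foldl (fun s a => (f s a).ret) s := by
  induction l generalizing s with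
  | nil => rfl
  | cons a l ih => simp [foldl, ih]

/-- A loop whose steps have amortized cost `c` with respect to the potential `Φ`. -/
theorem foldl_amortized {α σ : Type} (f : σ → α → Timed σ) (P : σ → Prop) (Φ : σ → ℕ) (c : ℕ)
    (l : List α)
    (h : ∀ s, ∀ a ∈ l, P s → P (f s a).ret ∧ (f s a).time + Φ (f s a).ret ≤ c + Φ s)
    (s : σ) (hs : P s) :
    P (foldl f s l).ret ∧
      (foldl f s l).time + Φ (foldl f s l).ret ≤ l.length * (c + 1) + Φ s := by
  induction l generalizing s with
  | nil => simpa [foldl] using hs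
  | cons a l ih =>
    obtain ⟨h₁, h₂⟩ := h s a (by simp) hs
    obtain ⟨h₃, h₄⟩ := ih (fun s b hb => h s b (by simp [hb])) _ h₁
    refine ⟨h₃, ?_⟩
    simp only [foldl, time_bind, time_tick, ret_bind, List.length_cons] at h₄ ⊢
    linarith

theorem time_foldl_le {α σ : Type} (f : σ → α → Timed σ) (c : ℕ) (l : List α)
    (h : ∀ s, ∀ a ∈ l, (f s a).time ≤ c) (s : σ) :
    (foldl f s l).time ≤ l.length * (c + 1) := by
  simpa using (foldl_amortized f (fun _ => True) (fun _ => 0) c l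
    (fun s a ha _ => ⟨trivial, by simpa using h s a ha⟩) s trivial).2

theorem ret_map {α β : Type} (f : α → Timed β) (l : List α) :
    (map f l).ret = l.map fun a => (f a).ret := by
  induction l with
  | nil => rfl
  | cons a l ih => simp [map, ih]

theorem time_map {α β : Type} (f : α → Timed β) (l : List α) :
    (map f l).time = l.length + (l.map fun a => (f a).time).sum := by
  induction l with
  | nil => rfl
  | cons a l ih => simp [map, ih]; ring

theorem ret_filter {α : Type} (p : α → Timed Bool) (l : List α) :
    (filter p l).ret = l.filter fun a => (p a).ret := by
  induction l with
  | nil => rfl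
  | cons a l ih => simp [filter, ih, List.filter_cons]

theorem time_filter_le {α : Type} (p : α → Timed Bool) (c : ℕ) (l : List α)
    (h : ∀ a ∈ l, (p a).time ≤ c) : (filter p l).time ≤ l.length * (c + 1) := by
  induction l with
  | nil => simp [filter]
  | cons a l ih =>
    have h₁ := h a (by simp)
    have h₂ := ih fun b hb => h b (by simp [hb])
    simp only [filter, time_bind, time_tick, time_pure, List.length_cons]
    linarith

/-! ### Insertion sort -/

section Sorting

variable {α β κ : Type} [LinearOrder κ] (key : α → κ)

theorem insertDesc_perm (a : α) (l : List α) : (insertDesc key a l).ret.Perm (a :: l) := by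
  induction l with
  | nil => simp [insertDesc]
  | cons b l ih =>
    simp only [insertDesc, ret_bind]
    split_ifs
    · simp
    · simp only [ret_bind, ret_pure]
      exact (ih.cons b).trans (List.Perm.swap a b l)

theorem insertDesc_pairwise (a : α) (l : List α)
    (h : l.Pairwise fun b c => key c ≤ key b) :
    (insertDesc key a l).ret.Pairwise fun b c => key c ≤ key b := by
  induction l with
  | nil => simp [insertDesc]
  | cons b l ih =>
    simp only [insertDesc, ret_bind]
    rw [List.pairwise_cons] at h
    split_ifs with hab
    · simp only [ret_pure, List.pairwise_cons, List.mem_cons]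
      refine ⟨?_, h⟩
      rintro c (rfl | hc)
      · exact hab
      · exact (h.1 c hc).trans hab
    · simp only [ret_bind, ret_pure, List.pairwise_cons]
      refine ⟨fun c hc => ?_, ih h.2⟩
      rcases List.mem_cons.1 ((insertDesc_perm key a l).subset hc) with rfl | hc
      · exact (not_le.1 hab).le
      · exact h.1 c hc

theorem time_insertDesc_le (a : α) (l : List α) : (insertDesc key a l).time ≤ l.length + 1 := by
  induction l with
  | nil => simp [insertDesc]
  | cons b l ih =>
    simp only [insertDesc, time_bind, time_tick, List.length_cons]
    split_ifs
    · simp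
    · simp only [time_bind, time_pure]
      omega

theorem sortDesc_perm (l : List α) : (sortDesc key l).ret.Perm l := by
  induction l with
  | nil => simp [sortDesc]
  | cons a l ih => exact (insertDesc_perm key a _).trans (ih.cons a)

theorem sortDesc_pairwise (l : List α) :
    (sortDesc key l).ret.Pairwise fun b c => key c ≤ key b := by
  induction l with
  | nil => simp [sortDesc]
  | cons a l ih => exact insertDesc_pairwise key a _ ih

theorem time_sortDesc_le (l : List α) : (sortDesc key l).time ≤ l.length * l.length := by
  induction l with
  | nil => simp [sortDesc]
  | cons a l ih =>
    have := time_insertDesc_le key a (sortDesc key l).ret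
    rw [(sortDesc_perm key l).length_eq] at this
    simp only [sortDesc, time_bind, List.length_cons]
    nlinarith

theorem insertDesc_map (f : β → α) (a : β) (l : List β) :
    (insertDesc key (f a) (l.map f)).ret = (insertDesc (fun b => key (f b)) a l).ret.map f := by
  induction l with
  | nil => simp [insertDesc]
  | cons b l ih =>
    simp only [insertDesc, ret_bind, List.map_cons]
    split_ifs
    · simp
    · simp [ih]

/-- Comparisons see only the keys. Sorting the computed pairs of the subtrees can therefore be read
as sorting the children themselves. -/
theorem sortDesc_map (f : β → α) (l : List β) :
    (sortDesc key (l.map f)).ret = (sortDesc (fun b => key (f b)) l).ret.map f := by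
  induction l with
  | nil => simp [sortDesc]
  | cons a l ih => simp [sortDesc, ih, insertDesc_map]

end Sorting

end Timed

@[simp] theorem CostModel.ret_charge {α : Type} (c : CostModel) (t : Timed α) :
    (c.charge t).ret = t.ret := by
  cases c <;> rfl

/-- Used for loops in which one item brings a property about and no later item can destroy it:
correctness of a table entry, membership of a node in the order. -/
theorem List.foldl_establishes {α σ : Type} {f : σ → α → σ} {P : σ → Prop} {l : List α}
    (hf : ∀ s a, P s → P (f s a)) {a : α} (ha : a ∈ l) (h : ∀ s, P (f s a)) (s : σ) :
    P (l.foldl f s) := by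
  have preserved : ∀ (l : List α) (s : σ), P s → P (l.foldl f s) := by
    intro l
    induction l with
    | nil => exact fun _ h => h
    | cons b l ih => exact fun s hs => ih _ (hf s b hs)
  induction l generalizing s with
  | nil => simp at ha
  | cons b l ih =>
    rcases List.mem_cons.1 ha with rfl | ha
    · exact preserved l _ (h s)
    · exact ih ha _

/-! ### Branches of a forest -/

namespace SimpleGraph

variable {V : Type*} {G : SimpleGraph V}

/-- The nodes that can be reached from `v` without entering `p`: the subtree below `v`, if `p` is
the parent of `v`. -/
def branch (G : SimpleGraph V) (p : Option V) (v : V) : Set V :=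
  {u | Relation.ReflTransGen (fun a b => G.Adj a b ∧ p ≠ some b) v u}

theorem self_mem_branch (p : Option V) (v : V) : v ∈ G.branch p v := Relation.ReflTransGen.refl

theorem mem_branch_of_adj {p : Option V} {v a b : V} (ha : a ∈ G.branch p v) (hab : G.Adj a b)
    (hb : p ≠ some b) : b ∈ G.branch p v :=
  Relation.ReflTransGen.tail ha ⟨hab, hb⟩

theorem parent_notMem_branch {p v : V} (h : p ≠ v) : p ∉ G.branch (some p) v := by
  intro hp
  rcases Relation.ReflTransGen.cases_tail hp with h' | ⟨b, -, -, hb⟩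
  · exact h h'
  · exact hb rfl

theorem ne_of_mem_branch {p v u : V} (h : p ≠ v) (hu : u ∈ G.branch (some p) v) : u ≠ p := by
  rintro rfl
  exact parent_notMem_branch h hu

/-- Walks reverse: a reversed step enters a vertex of the branch, and no such vertex is `p` because
the start is not `p`. -/
theorem mem_branch_symm {p u v : V} (h : p ≠ v) (hu : u ∈ G.branch (some p) v) :
    v ∈ G.branch (some p) u := by
  induction hu with
  | refl => exact self_mem_branch _ _
  | tail hab hbc ih =>
    refine Relation.ReflTransGen.head ⟨hbc.1.symm, ?_⟩ ih
    exact fun h' => ne_of_mem_branch h hab (Option.some.inj h').symm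

theorem mem_branch_trans {p : Option V} {u v w : V} (h₁ : v ∈ G.branch p u)
    (h₂ : w ∈ G.branch p v) : w ∈ G.branch p u :=
  Relation.ReflTransGen.trans h₁ h₂

/-- In a forest, only the top node of a branch is adjacent to the parent. -/
theorem IsAcyclic.eq_of_mem_branch (hG : G.IsAcyclic) {p v w : V} (hv : G.Adj p v)
    (hw : G.Adj p w) (h : w ∈ G.branch (some p) v) : w = v := by
  -- Otherwise the edge `pv`, followed by the walk from `v` to `w` that never enters `p`, joins `p`
  -- to `w` without the edge `pw`. But every edge of a forest is a bridge.
  by_contra hne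
  have hb := isAcyclic_iff_forall_adj_isBridge.1 hG hw
  rw [isBridge_iff] at hb
  apply hb
  have reach : ∀ u, u ∈ G.branch (some p) v → (G.deleteEdges {s(p, w)}).Reachable v u := by
    intro u hu
    induction hu with
    | refl => rfl
    | @tail b c hab hbc ih =>
      refine ih.trans (Adj.reachable ?_)
      rw [deleteEdges_adj]
      refine ⟨hbc.1, fun h' => ?_⟩
      have hb' : b ≠ p := ne_of_mem_branch hv.ne hab
      have hc' : c ≠ p := fun h => hbc.2 (by rw [h])
      rcases Sym2.eq_iff.1 (Set.mem_singleton_iff.1 h') with ⟨h, -⟩ | ⟨-, h⟩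
      · exact hb' h
      · exact hc' h
  refine (Adj.reachable ?_).trans (reach w h)
  rw [deleteEdges_adj]
  refine ⟨hv, fun h' => ?_⟩
  rcases Sym2.eq_iff.1 (Set.mem_singleton_iff.1 h') with ⟨-, h⟩ | ⟨-, h⟩
  · exact hne h.symm
  · exact hv.ne h.symm

section Children

variable {p : Option V} {v : V}

/-- A walk from the child `a` that avoids `v` never meets the parent `p`: both are neighbours of
`v`, and `a` is the only neighbour of `v` in its branch. -/
theorem IsAcyclic.branch_child_subset (hG : G.IsAcyclic) (hp : ∀ q, p = some q → G.Adj v q)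
    {a : V} (ha : G.Adj v a) (hpa : p ≠ some a) : G.branch (some v) a ⊆ G.branch p v := by
  intro u hu
  have hq : ∀ b ∈ G.branch (some v) a, p ≠ some b := by
    rintro b hb rfl
    exact hpa (by rw [hG.eq_of_mem_branch ha (hp b rfl) hb])
  have ha' : a ∈ G.branch p v := mem_branch_of_adj (self_mem_branch _ _) ha hpa
  induction hu with
  | refl => exact ha'
  | tail hab hbc ih => exact mem_branch_of_adj ih hbc.1 (hq _ (mem_branch_of_adj hab hbc.1 hbc.2))

theorem IsAcyclic.mem_branch_iff (hG : G.IsAcyclic) (hp : ∀ q, p = some q → G.Adj v q) {u : V} :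
    u ∈ G.branch p v ↔ u = v ∨ ∃ a, (G.Adj v a ∧ p ≠ some a) ∧ u ∈ G.branch (some v) a := by
  constructor
  · intro hu
    induction hu with
    | refl => exact Or.inl rfl
    | @tail b c hab hbc ih =>
      by_cases hc : c = v
      · exact Or.inl hc
      · refine Or.inr ?_
        rcases ih with rfl | ⟨a, ha, hb⟩
        · exact ⟨c, hbc, self_mem_branch _ _⟩
        · exact ⟨a, ha, mem_branch_of_adj hb hbc.1 fun h => hc (Option.some.inj h).symm⟩
  · rintro (rfl | ⟨a, ha, hu⟩)
    · exact self_mem_branch _ _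
    · exact hG.branch_child_subset hp ha.1 ha.2 hu

/-- A common vertex would link `a` to `b` by a walk avoiding `v`, although a branch contains only
one neighbour of `v`. -/
theorem IsAcyclic.branch_disjoint (hG : G.IsAcyclic) {a b : V} (ha : G.Adj v a) (hb : G.Adj v b)
    (hab : a ≠ b) : Disjoint (G.branch (some v) a) (G.branch (some v) b) := by
  rw [Set.disjoint_left]
  intro u hu hu'
  exact hab (hG.eq_of_mem_branch ha hb
    (mem_branch_trans hu (mem_branch_symm hb.ne hu'))).symm

end Children

end SimpleGraph

/-! ### Boundary nodes while a subtree is explored -/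

namespace GroupStructure

open SimpleGraph

variable {N M : ℕ} (𝔊 : GroupStructure N M)

theorem mem_boundary {S : Finset (Fin M)} {v : Fin M} :
    v ∈ 𝔊.boundary S ↔ v ∈ S ∧ ∃ u, u ∉ S ∧ 𝔊.groupGraph.Adj v u := by
  simp [boundary]

theorem adjacent_ret (i j : Fin M) :
    (𝔊.adjacent i j).ret = true ↔ 𝔊.groupGraph.Adj i j := by
  simp [adjacent, groupGraph]

/-- The nodes of the list `L` that are boundary nodes of `S`. -/
noncomputable def boundaryIn (S : Finset (Fin M)) (L : List (Fin M)) : Finset (Fin M) :=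
  (𝔊.boundary S).filter (· ∈ L)

theorem mem_boundaryIn {S : Finset (Fin M)} {L : List (Fin M)} {v : Fin M} :
    v ∈ 𝔊.boundaryIn S L ↔ v ∈ 𝔊.boundary S ∧ v ∈ L := by
  simp [boundaryIn]

/-- The list `L` enumerates the branch at `v`, with at most `D` boundary nodes at every step, and
the branch has at least `2 ^ D - 1` nodes. -/
structure Explores (p : Option (Fin M)) (v : Fin M) (D : ℕ) (L : List (Fin M)) : Prop where
  nodup : L.Nodup
  mem_iff : ∀ u, u ∈ L ↔ u ∈ 𝔊.groupGraph.branch p v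
  two_pow_le : 2 ^ D ≤ L.length + 1
  boundary_le : ∀ (S : Finset (Fin M)) (m : ℕ), (∀ u ∈ L, u ∈ S ↔ u ∈ L.take m) →
    (𝔊.boundaryIn S L).card ≤ D

variable {𝔊}

theorem boundaryIn_eq_empty_of_notMem {S : Finset (Fin M)} {L : List (Fin M)}
    (h : ∀ u ∈ L, u ∉ S) : 𝔊.boundaryIn S L = ∅ := by
  refine Finset.eq_empty_of_forall_notMem fun u hu => ?_
  rw [mem_boundaryIn, mem_boundary] at hu
  exact h u hu.2 hu.1.1

theorem boundaryIn_append_subset (S : Finset (Fin M)) (L L' : List (Fin M)) :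
    𝔊.boundaryIn S (L ++ L') ⊆ 𝔊.boundaryIn S L ∪ 𝔊.boundaryIn S L' := by
  intro u
  simp only [Finset.mem_union, mem_boundaryIn, List.mem_append]
  tauto

/-- Every neighbour of a node of a completed subtree lies in the subtree or is the explored node
`v`. -/
theorem Explores.boundaryIn_eq_empty {v u : Fin M} {D : ℕ} {L : List (Fin M)}
    (h : 𝔊.Explores (some v) u D L) {S : Finset (Fin M)} (hv : v ∈ S) (hL : ∀ w ∈ L, w ∈ S) :
    𝔊.boundaryIn S L = ∅ := by
  refine Finset.eq_empty_of_forall_notMem fun w hw => ?_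
  rw [mem_boundaryIn, mem_boundary] at hw
  obtain ⟨⟨-, z, hz, hadj⟩, hw⟩ := hw
  refine hz (hL z ((h.mem_iff z).2 (mem_branch_of_adj ((h.mem_iff w).1 hw) hadj ?_)))
  rintro h'
  exact hz (Option.some.inj h' ▸ hv)

/-- Truncated subtraction leaves the second prefix empty until the first list is used up. -/
theorem mem_take_append_iff {α : Type*} {L R : List α} (hd : L.Disjoint R) (m : ℕ) :
    (∀ u ∈ L, u ∈ (L ++ R).take m ↔ u ∈ L.take m) ∧
      ∀ u ∈ R, u ∈ (L ++ R).take m ↔ u ∈ R.take (m - L.length) := by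
  constructor <;> intro u hu <;> rw [List.take_append, List.mem_append]
  · exact or_iff_left fun h => hd hu (List.mem_of_mem_take h)
  · exact or_iff_right fun h => hd (List.mem_of_mem_take h) hu

/-- The subtrees below an explored node `v` are explored one after the other. -/
theorem boundaryIn_flatMap_card_le {v : Fin M} {d : ℕ} {D : Fin M → ℕ}
    {L : Fin M → List (Fin M)} (cs : List (Fin M))
    (hcs : ∀ u ∈ cs, 𝔊.Explores (some v) u (D u) (L u)) (hd : ∀ u ∈ cs, D u ≤ d)
    (hnd : (cs.flatMap L).Nodup) (S : Finset (Fin M)) (hv : v ∈ S) (m : ℕ)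
    (hS : ∀ u ∈ cs.flatMap L, u ∈ S ↔ u ∈ (cs.flatMap L).take m) :
    (𝔊.boundaryIn S (cs.flatMap L)).card ≤ d := by
  induction cs generalizing m with
  | nil => simp [boundaryIn]
  | cons c cs ih =>
    rw [List.flatMap_cons] at hnd hS ⊢
    obtain ⟨-, hnd₂, hdis⟩ := List.nodup_append'.1 hnd
    obtain ⟨h₁, h₂⟩ := mem_take_append_iff hdis m
    have hc := hcs c (by simp)
    have hS₁ : ∀ u ∈ L c, u ∈ S ↔ u ∈ (L c).take m := fun u hu =>
      (hS u (List.mem_append_left _ hu)).trans (h₁ u hu)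
    have hS₂ : ∀ u ∈ cs.flatMap L, u ∈ S ↔ u ∈ (cs.flatMap L).take (m - (L c).length) :=
      fun u hu => (hS u (List.mem_append_right _ hu)).trans (h₂ u hu)
    refine (Finset.card_le_card (boundaryIn_append_subset _ _ _)).trans ?_
    -- Either the first subtree is still in progress and the others are untouched, or it is
    -- completed and contributes nothing.
    rcases le_or_gt m (L c).length with hm | hm
    · rw [boundaryIn_eq_empty_of_notMem (L := cs.flatMap L), Finset.union_empty]
      · exact (hc.boundary_le S m hS₁).trans (hd c (by simp))
      · intro u hu
        rw [hS₂ u hu, Nat.sub_eq_zero_of_le hm]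
        simp
    · rw [hc.boundaryIn_eq_empty hv, Finset.empty_union]
      · exact ih (fun u hu => hcs u (by simp [hu])) (fun u hu => hd u (by simp [hu])) hnd₂ _ hS₂
      · intro w hw
        rw [hS₁ w hw, List.take_of_length_le hm.le]
        exact hw

theorem Explores.singleton {p : Option (Fin M)} {v : Fin M}
    (h : ∀ u, u ∈ 𝔊.groupGraph.branch p v ↔ u = v) : 𝔊.Explores p v 1 [v] where
  nodup := by simp
  mem_iff u := by simp [h]
  two_pow_le := by simp
  boundary_le S m _ := by
    refine (Finset.card_le_card (t := {v}) fun u hu => ?_).trans (by simp)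
    rw [mem_boundaryIn] at hu
    simpa using hu.2

/-- Exploring the first subtree, then the node, then the other subtrees. -/
theorem Explores.node {p : Option (Fin M)} {v c : Fin M} {cs : List (Fin M)} {D : Fin M → ℕ}
    {L : Fin M → List (Fin M)} {d : ℕ} (hc : ∀ u ∈ c :: cs, 𝔊.Explores (some v) u (D u) (L u))
    (hnd : (L c ++ v :: cs.flatMap L).Nodup)
    (hmem : ∀ u, u ∈ 𝔊.groupGraph.branch p v ↔ u ∈ L c ++ v :: cs.flatMap L)
    (hd : ∀ u ∈ cs, D u ≤ d) (hdc : d ≤ D c) (hex : d = 0 ∨ ∃ u ∈ cs, D u = d) :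
    𝔊.Explores p v (max (D c) (d + 1)) (L c ++ v :: cs.flatMap L) where
  nodup := hnd
  mem_iff u := (hmem u).symm
  two_pow_le := by
    have h₁ := (hc c (by simp)).two_pow_le
    have h₂ : 2 ^ d ≤ (cs.flatMap L).length + 1 := by
      rcases hex with rfl | ⟨u, hu, rfl⟩
      · simp
      · refine (hc u (by simp [hu])).two_pow_le.trans ?_
        have : (L u).Sublist (cs.flatMap L) := List.sublist_flatten_of_mem (List.mem_map_of_mem hu)
        have := this.length_le
        omega
    have h₃ : 2 ^ d ≤ 2 ^ D c := Nat.pow_le_pow_right (by norm_num) hdc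
    rw [List.length_append, List.length_cons]
    -- If the maximum is `d + 1`, the first subtree and the remaining ones each have at least `2 ^ d
    -- - 1` nodes, and `v` supplies one more.
    rcases le_total (D c) (d + 1) with h | h
    · rw [max_eq_right h, pow_succ]
      omega
    · rw [max_eq_left h]
      omega
  boundary_le S m hS := by
    obtain ⟨-, hnd₂, hdis⟩ := List.nodup_append'.1 hnd
    obtain ⟨h₁, h₂⟩ := mem_take_append_iff hdis m
    have hS₁ : ∀ u ∈ L c, u ∈ S ↔ u ∈ (L c).take m := fun u hu =>
      (hS u (List.mem_append_left _ hu)).trans (h₁ u hu)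
    have hS₂ : ∀ u ∈ v :: cs.flatMap L,
        u ∈ S ↔ u ∈ (v :: cs.flatMap L).take (m - (L c).length) :=
      fun u hu => (hS u (List.mem_append_right _ hu)).trans (h₂ u hu)
    have hc₁ := hc c (by simp)
    refine (Finset.card_le_card (boundaryIn_append_subset _ _ _)).trans ?_
    rcases le_or_gt m (L c).length with hm | hm
    · rw [boundaryIn_eq_empty_of_notMem (L := v :: cs.flatMap L), Finset.union_empty]
      · exact (hc₁.boundary_le S m hS₁).trans (le_max_left _ _)
      · intro u hu
        rw [hS₂ u hu, Nat.sub_eq_zero_of_le hm]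
        simp
    -- The prefix reaches beyond the first subtree, so it contains `v`; the remaining `k` picks lie
    -- in the other subtrees.
    · obtain ⟨k, hk⟩ : ∃ k, m - (L c).length = k + 1 := ⟨m - (L c).length - 1, by omega⟩
      rw [hk, List.take_succ_cons] at hS₂
      have hv : v ∈ S := (hS₂ v (by simp)).2 (by simp)
      rw [hc₁.boundaryIn_eq_empty hv, Finset.empty_union]
      · have h := boundaryIn_flatMap_card_le cs (fun u hu => hc u (by simp [hu])) hd
          (List.nodup_cons.1 hnd₂).2 S hv k fun u hu => by
            rw [hS₂ u (List.mem_cons_of_mem _ hu), List.mem_cons]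
            refine or_iff_right ?_
            rintro rfl
            exact (List.nodup_cons.1 hnd₂).1 hu
        refine le_trans ?_ (le_max_right _ _)
        have hsub : 𝔊.boundaryIn S (v :: cs.flatMap L) ⊆
            insert v (𝔊.boundaryIn S (cs.flatMap L)) := by
          intro u
          simp only [Finset.mem_insert, mem_boundaryIn, List.mem_cons]
          tauto
        exact (Finset.card_le_card hsub).trans ((Finset.card_insert_le _ _).trans (by omega))
      · intro w hw
        rw [hS₁ w hw, List.take_of_length_le hm.le]
        exact hw

end GroupStructure

/-! ### Analysis of the node picking rule -/

namespace GroupStructure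

open SimpleGraph Timed

variable {N M : ℕ} {𝔊 : GroupStructure N M}

/-- The nodes from which the subtrees below `v` start, where `p` is the parent of `v`. -/
def children (𝔊 : GroupStructure N M) (p : Option (Fin M)) (v : Fin M) : List (Fin M) :=
  (List.finRange M).filter fun u => (𝔊.adjacent v u).ret && decide (p ≠ some u)

theorem mem_children {p : Option (Fin M)} {v u : Fin M} :
    u ∈ 𝔊.children p v ↔ 𝔊.groupGraph.Adj v u ∧ p ≠ some u := by
  simp [children, adjacent_ret]

theorem length_le_of_nodup {L : List (Fin M)} (h : L.Nodup) : L.length ≤ M := by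
  simpa using h.length_le_card

theorem pick_succ_ret (c : CostModel) (n : ℕ) (p : Option (Fin M)) (v : Fin M) :
    ∃ cs : List (Fin M), cs.Perm (𝔊.children p v) ∧
      (cs.Pairwise fun a b => (𝔊.pick c n (some v) b).ret.1 ≤ (𝔊.pick c n (some v) a).ret.1) ∧
      (𝔊.pick c (n + 1) p v).ret =
        (max ((cs.map fun u => (𝔊.pick c n (some v) u).ret.1).getD 0 0)
          ((cs.map fun u => (𝔊.pick c n (some v) u).ret.1).getD 1 0 + 1),
         (cs.take 1).flatMap (fun u => (𝔊.pick c n (some v) u).ret.2) ++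
          v :: (cs.drop 1).flatMap (fun u => (𝔊.pick c n (some v) u).ret.2)) ∧
      (𝔊.pick c (n + 1) p v).time =
        (Timed.filter (fun u => do
          let b ← c.charge (𝔊.adjacent v u)
          pure (b && decide (p ≠ some u))) (List.finRange M)).time + (cs.length +
        (cs.map fun u => (𝔊.pick c n (some v) u).time).sum +
        ((sortDesc Prod.fst
          ((𝔊.children p v).map fun u => (𝔊.pick c n (some v) u).ret)).time +
        (𝔊.pick c (n + 1) p v).ret.2.length)) := by
  have hsort := sortDesc_map (Prod.fst (α := ℕ) (β := List (Fin M)))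
    (fun u => (𝔊.pick c n (some v) u).ret) (𝔊.children p v)
  have hperm := sortDesc_perm (fun u => (𝔊.pick c n (some v) u).ret.1) (𝔊.children p v)
  have hret : (𝔊.pick c (n + 1) p v).ret =
        (max (((sortDesc (fun u => (𝔊.pick c n (some v) u).ret.1) (𝔊.children p v)).ret.map
            fun u => (𝔊.pick c n (some v) u).ret.1).getD 0 0)
          (((sortDesc (fun u => (𝔊.pick c n (some v) u).ret.1) (𝔊.children p v)).ret.map
            fun u => (𝔊.pick c n (some v) u).ret.1).getD 1 0 + 1),
         ((sortDesc (fun u => (𝔊.pick c n (some v) u).ret.1) (𝔊.children p v)).ret.take 1).flatMap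
            (fun u => (𝔊.pick c n (some v) u).ret.2) ++
          v :: ((sortDesc (fun u => (𝔊.pick c n (some v) u).ret.1)
            (𝔊.children p v)).ret.drop 1).flatMap (fun u => (𝔊.pick c n (some v) u).ret.2)) := by
    simp only [pick, ret_bind, ret_pure, ret_filter, ret_map, CostModel.ret_charge]
    rw [← children, hsort]
    simp only [List.map_take, List.map_drop, List.flatMap, List.map_map, Function.comp_def]
  refine ⟨_, hperm, sortDesc_pairwise _ _, hret, ?_⟩
  rw [hperm.length_eq, (hperm.map _).sum_eq]
  simp only [pick, ret_bind, ret_pure, time_bind, time_pure, time_tick, ret_filter, ret_map,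
    time_map, CostModel.ret_charge, Nat.add_zero]
  rfl

/-- The depth bound suffices because the branch of a child omits `v` and is strictly smaller. The
surplus `M + 2` in the time bound is credit that each subtree leaves to its parent, for the loop
overhead and at most `M` comparisons per child. The share `M * (a + 2)` of a node pays for its
adjacency tests and for the concatenation. -/
theorem pick_spec (hG : 𝔊.groupGraph.IsAcyclic) {c : CostModel} {a : ℕ}
    (ha : ∀ i j, (c.charge (𝔊.adjacent i j)).time ≤ a) (n : ℕ) (p : Option (Fin M)) (v : Fin M)
    (hp : ∀ q, p = some q → 𝔊.groupGraph.Adj v q) (hn : (𝔊.groupGraph.branch p v).ncard ≤ n) :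
    𝔊.Explores p v (𝔊.pick c n p v).ret.1 (𝔊.pick c n p v).ret.2 ∧
      (𝔊.pick c n p v).time + (M + 2) ≤
        (M * (a + 2) + (M + 2)) * (𝔊.pick c n p v).ret.2.length := by
  induction n generalizing p v with
  | zero =>
    rw [Nat.le_zero, Set.ncard_eq_zero] at hn
    exact absurd (self_mem_branch p v) (hn ▸ Set.notMem_empty v)
  | succ n ih =>
    obtain ⟨cs, hperm, hsorted, hret, htime⟩ := pick_succ_ret (𝔊 := 𝔊) c n p v
    set D : Fin M → ℕ := fun u => (𝔊.pick c n (some v) u).ret.1 with hD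
    set L : Fin M → List (Fin M) := fun u => (𝔊.pick c n (some v) u).ret.2 with hL
    have hchild : ∀ u, u ∈ cs ↔ 𝔊.groupGraph.Adj v u ∧ p ≠ some u := fun u => by
      rw [hperm.mem_iff, mem_children]
    have hcsnd : cs.Nodup := hperm.nodup_iff.2 ((List.nodup_finRange M).filter _)
    have hsub : ∀ u ∈ cs, 𝔊.Explores (some v) u (D u) (L u) ∧
        (𝔊.pick c n (some v) u).time + (M + 2) ≤ (M * (a + 2) + (M + 2)) * (L u).length := by
      intro u hu
      obtain ⟨hu₁, hu₂⟩ := (hchild u).1 hu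
      refine ih (some v) u (fun q hq => Option.some.inj hq ▸ hu₁.symm) ?_
      refine Nat.le_of_lt_succ (lt_of_lt_of_le (Set.ncard_lt_ncard ?_ (Set.toFinite _)) hn)
      refine ⟨hG.branch_child_subset hp hu₁ hu₂, fun h => ?_⟩
      exact parent_notMem_branch hu₁.ne (h (self_mem_branch p v))
    have hvL : ∀ u ∈ cs, v ∉ L u := fun u hu h =>
      parent_notMem_branch ((hchild u).1 hu).1.ne (((hsub u hu).1.mem_iff v).1 h)
    have hflat : (cs.flatMap L).Nodup := by
      rw [List.nodup_flatMap]
      refine ⟨fun u hu => (hsub u hu).1.nodup, ?_⟩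
      refine hcsnd.pairwise_of_forall_ne fun u hu w hw huw => ?_
      intro z hz hz'
      exact Set.disjoint_left.1 (hG.branch_disjoint ((hchild u).1 hu).1 ((hchild w).1 hw).1 huw)
        (((hsub u hu).1.mem_iff z).1 hz) (((hsub w hw).1.mem_iff z).1 hz')
    have hvflat : v ∉ cs.flatMap L := by
      rw [List.mem_flatMap]
      rintro ⟨u, hu, h⟩
      exact hvL u hu h
    have horder : ((cs.take 1).flatMap L ++ v :: (cs.drop 1).flatMap L).Perm
        (v :: cs.flatMap L) := by
      refine List.perm_middle.trans ?_
      rw [← List.flatMap_append, List.take_append_drop]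
    have hnd : ((cs.take 1).flatMap L ++ v :: (cs.drop 1).flatMap L).Nodup :=
      horder.nodup_iff.2 (List.nodup_cons.2 ⟨hvflat, hflat⟩)
    have hmem : ∀ u, u ∈ 𝔊.groupGraph.branch p v ↔
        u ∈ (cs.take 1).flatMap L ++ v :: (cs.drop 1).flatMap L := by
      intro u
      rw [horder.mem_iff, hG.mem_branch_iff hp, List.mem_cons, List.mem_flatMap]
      refine or_congr_right (exists_congr fun b => ?_)
      rw [hchild]
      exact and_congr_right fun hb => ((hsub b ((hchild b).2 hb)).1.mem_iff u).symm
    constructor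
    · rw [hret]
      rcases cs with - | ⟨b, cs⟩
      · refine Explores.singleton fun u => ?_
        simpa using hmem u
      · have hsub' := fun u hu => (hsub u hu).1
        simp only [List.take_succ_cons, List.take_zero, List.drop_succ_cons, List.drop_zero,
          List.flatMap_cons, List.flatMap_nil, List.append_nil] at hnd hmem ⊢
        simp only [List.map_cons, List.getD_cons_zero, List.getD_cons_succ]
        rw [List.pairwise_cons] at hsorted
        rcases cs with - | ⟨b', cs⟩
        -- With a single child, `D₂` takes the default value `0`.
        · exact Explores.node (D := D) hsub' hnd hmem (d := 0) (by simp) (by simp) (by simp)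
        · simp only [List.map_cons, List.getD_cons_zero]
          refine Explores.node (D := D) hsub' hnd hmem (d := D b') ?_ ?_ ?_
          · intro u hu
            rcases List.mem_cons.1 hu with rfl | hu
            · exact le_rfl
            · exact (List.pairwise_cons.1 hsorted.2).1 u hu
          · exact hsorted.1 b' (by simp)
          · exact Or.inr ⟨b', by simp, rfl⟩
    · have h₁ := time_filter_le (fun u => do
          let b ← c.charge (𝔊.adjacent v u)
          pure (b && decide (p ≠ some u))) a (List.finRange M) fun u _ => by
        simpa using ha v u
      have h₂ := time_sortDesc_le Prod.fst
        ((𝔊.children p v).map fun u => (𝔊.pick c n (some v) u).ret)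
      rw [List.length_map, ← hperm.length_eq] at h₂
      rw [List.length_finRange] at h₁
      have h₃ := length_le_of_nodup hcsnd
      have h₄ := length_le_of_nodup hnd
      have h₅ : cs.length * cs.length ≤ cs.length * M := Nat.mul_le_mul_left _ h₃
      have h₆ : (cs.map fun u => (𝔊.pick c n (some v) u).time).sum + cs.length * (M + 2) ≤
          (M * (a + 2) + (M + 2)) * (cs.flatMap L).length := by
        have : ∀ cs : List (Fin M), (∀ u ∈ cs, (𝔊.pick c n (some v) u).time + (M + 2) ≤
            (M * (a + 2) + (M + 2)) * (L u).length) →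
            (cs.map fun u => (𝔊.pick c n (some v) u).time).sum + cs.length * (M + 2) ≤
              (M * (a + 2) + (M + 2)) * (cs.flatMap L).length := by
          intro cs
          induction cs with
          | nil => simp
          | cons b cs ih =>
            intro h
            have h₁ := h b (by simp)
            have h₂ := ih fun u hu => h u (by simp [hu])
            simp only [List.map_cons, List.sum_cons, List.length_cons, List.flatMap_cons,
              List.length_append]
            linarith
        exact this cs fun u hu => (hsub u hu).2
      rw [htime, hret]
      change _ + (_ + (_ + List.length (_ ++ _))) + _ ≤ _ * List.length (_ ++ _)
      have h₇ := horder.length_eq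
      rw [List.length_cons] at h₇
      rw [h₇] at h₄ ⊢
      linarith

/-- The list `acc` enumerates a union of trees, with few boundary nodes at every step. -/
structure ExploresTrees (𝔊 : GroupStructure N M) (acc : List (Fin M)) : Prop where
  nodup : acc.Nodup
  closed : ∀ u ∈ acc, ∀ w, 𝔊.groupGraph.Adj u w → w ∈ acc
  two_pow_le : ∀ m, 2 ^ (𝔊.boundary (acc.take m).toFinset).card ≤ M + 1

/-- Since `acc` is closed under adjacency, the new tree is disjoint from it, and once all of `acc`
is explored only nodes of the new tree can be boundary nodes. -/
theorem ExploresTrees.append {acc : List (Fin M)} (h : 𝔊.ExploresTrees acc) {v : Fin M}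
    (hv : v ∉ acc) {D : ℕ} {L : List (Fin M)} (hL : 𝔊.Explores none v D L) :
    𝔊.ExploresTrees (acc ++ L) := by
  have hdis : acc.Disjoint L := by
    intro u hu hu'
    have hb := (hL.mem_iff u).1 hu'
    have : ∀ w, w ∈ 𝔊.groupGraph.branch none v → w ∉ acc := by
      intro w hw
      induction hw with
      | refl => exact hv
      | tail _ hbc ih => exact fun hc => ih (h.closed _ hc _ hbc.1.symm)
    exact this u hb hu
  refine ⟨List.nodup_append'.2 ⟨h.nodup, hL.nodup, hdis⟩, ?_, fun m => ?_⟩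
  · intro u hu w hw
    rw [List.mem_append] at hu ⊢
    refine hu.imp (fun hu => h.closed u hu w hw) fun hu => ?_
    exact (hL.mem_iff w).2 (mem_branch_of_adj ((hL.mem_iff u).1 hu) hw (by simp))
  · rcases le_or_gt m acc.length with hm | hm
    · rw [List.take_append_of_le_length hm]
      exact h.two_pow_le m
    · have hsub : 𝔊.boundary ((acc ++ L).take m).toFinset ⊆
          𝔊.boundaryIn ((acc ++ L).take m).toFinset L := by
        intro u hu
        rw [mem_boundaryIn]
        refine ⟨hu, ?_⟩
        rw [mem_boundary] at hu
        obtain ⟨hu, w, hw, hadj⟩ := hu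
        rw [List.mem_toFinset, List.take_append, List.take_of_length_le hm.le,
          List.mem_append] at hu hw
        rcases hu with hu | hu
        · exact absurd (Or.inl (h.closed u hu w hadj)) hw
        · exact List.mem_of_mem_take hu
      have hcard := (Finset.card_le_card hsub).trans (hL.boundary_le _ (m - acc.length)
        fun u hu => by rw [List.mem_toFinset, (mem_take_append_iff hdis m).2 u hu])
      refine (Nat.pow_le_pow_right (by norm_num) hcard).trans (hL.two_pow_le.trans ?_)
      have := length_le_of_nodup hL.nodup
      omega

/-- The potential is proportional to the number of nodes not yet listed: it pays for each tree by
its size and leaves `2 * M` per candidate root for scanning and appending. -/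
theorem nodeOrder_spec (hG : 𝔊.groupGraph.IsAcyclic) {c : CostModel} {a : ℕ}
    (ha : ∀ i j, (c.charge (𝔊.adjacent i j)).time ≤ a) (root : Equiv.Perm (Fin M)) :
    𝔊.ExploresTrees (𝔊.nodeOrder c root).ret ∧ (∀ v, v ∈ (𝔊.nodeOrder c root).ret) ∧
      (𝔊.nodeOrder c root).time ≤
        M * (2 * M + 1) + (M * (a + 2) + (M + 2)) * M := by
  have pick_none := fun v => pick_spec hG ha M none v (by simp) (by
    simpa using Set.ncard_le_card (𝔊.groupGraph.branch none v))
  have mem_pick : ∀ v, v ∈ (𝔊.pick c M none v).ret.2 := fun v =>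
    ((pick_none v).1.mem_iff v).2 (self_mem_branch _ _)
  obtain ⟨h₁, h₂⟩ := foldl_amortized (fun (acc : List (Fin M)) v => do
    tick acc.length
    if v ∈ acc then
      pure acc
    else do
      let t ← 𝔊.pick c M none v
      tick (acc.length + t.2.length)
      pure (acc ++ t.2)) 𝔊.ExploresTrees
    (fun acc => (M * (a + 2) + (M + 2)) * (M - acc.length)) (2 * M)
    ((List.finRange M).map root) (by
      intro acc v _ hacc
      have hlen := length_le_of_nodup hacc.nodup
      by_cases hv : v ∈ acc
      · simpa [hv] using ⟨hacc, by omega⟩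
      · have happ := hacc.append hv (pick_none v).1
        have hlen' := length_le_of_nodup happ.nodup
        simp only [hv, if_false, ret_bind, ret_pure, time_bind, time_tick, time_pure]
        refine ⟨happ, ?_⟩
        have htime := (pick_none v).2
        rw [List.length_append] at hlen' ⊢
        obtain ⟨r, hr⟩ := Nat.exists_eq_add_of_le hlen'
        rw [show M - acc.length = (𝔊.pick c M none v).ret.2.length + r by omega,
          show M - (acc.length + (𝔊.pick c M none v).ret.2.length) = r by omega,
          Nat.mul_add _ (List.length _) r]
        omega) []
    ⟨by simp, by simp, fun m => by simp [boundary]⟩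
  refine ⟨h₁, fun v => ?_, ?_⟩
  · rw [nodeOrder, ret_foldl]
    refine List.foldl_establishes (P := fun acc => v ∈ acc) (a := v) ?_
      (List.mem_map.2 ⟨root.symm v, by simp, by simp⟩) ?_ _
    · intro acc u hacc
      by_cases hu : u ∈ acc <;> simp [hu, hacc]
    · intro acc
      by_cases hv : v ∈ acc <;> simp [hv, mem_pick v]
  · simp only [List.length_map, List.length_finRange, List.length_nil, Nat.sub_zero] at h₂
    exact (Nat.le_add_right _ _).trans h₂

end GroupStructure

/-! ### Tables and their invariant -/

namespace GroupStructure

open Timed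

variable {N M : ℕ} {𝔊 : GroupStructure N M} {x : Fin N → ℝ}

theorem mem_assignments {B : List (Fin M)} {I : Assignment M} :
    I ∈ assignments B ↔ (∀ j ∈ B, I j ≠ 2) ∧ ∀ j ∉ B, I j = 2 := by
  induction B generalizing I with
  | nil =>
    simp only [assignments, List.mem_singleton, List.not_mem_nil, false_imp_iff, implies_true,
      true_and, not_false_eq_true, true_imp_iff]
    exact funext_iff
  | cons b B ih =>
    simp only [assignments, List.mem_flatMap, List.mem_cons, List.not_mem_nil, or_false]
    constructor
    · rintro ⟨I', hI', h⟩
      rw [ih] at hI'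
      have hb : I b ≠ 2 := by rcases h with rfl | rfl <;> simp
      have hne : ∀ j, j ≠ b → I j = I' j := fun j hj => by rcases h with rfl | rfl <;> simp [hj]
      refine ⟨fun j hj => ?_, fun j hj => ?_⟩
      · by_cases hjb : j = b
        · rwa [hjb]
        · rw [hne j hjb]
          exact hI'.1 j (hj.resolve_left hjb)
      · rw [hne j fun h => hj (Or.inl h)]
        exact hI'.2 j fun h => hj (Or.inr h)
    · rintro ⟨h₁, h₂⟩
      -- If `b` is repeated, `I` is already an assignment on `B` and one of the two updates leaves
      -- it unchanged. Otherwise `b` must be reset to `2` first.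
      by_cases hbB : b ∈ B
      · refine ⟨I, ih.2 ⟨fun j hj => h₁ j (Or.inr hj), fun j hj => h₂ j ?_⟩, ?_⟩
        · rintro (rfl | h)
          exacts [hj hbB, hj h]
        · have := h₁ b (Or.inl rfl)
          rw [eq_comm, Function.update_eq_self_iff, eq_comm (a := I),
            Function.update_eq_self_iff]
          omega
      · refine ⟨Function.update I b 2, ih.2 ⟨fun j hj => ?_, fun j hj => ?_⟩, ?_⟩
        · rw [Function.update_of_ne (by rintro rfl; exact hbB hj)]
          exact h₁ j (Or.inr hj)
        · by_cases hjb : j = b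
          · rw [hjb, Function.update_self]
          · rw [Function.update_of_ne hjb]
            exact h₂ j fun h => h.elim hjb hj
        · have := h₁ b (Or.inl rfl)
          simp only [Function.update_idem]
          rw [eq_comm, Function.update_eq_self_iff, eq_comm (a := I),
            Function.update_eq_self_iff]
          omega

theorem length_assignments (B : List (Fin M)) : (assignments B).length = 2 ^ B.length := by
  induction B with
  | nil => rfl
  | cons b B ih => simp [assignments, List.length_flatMap, ih, pow_succ]

/-- An entry whose selection consists of at most `k` distinct elements of at most `g` distinct
groups of `S` that are not forbidden, and attains its value. -/
structure IsSelection (𝔊 : GroupStructure N M) (x : Fin N → ℝ) (S : Finset (Fin M))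
    (I : Assignment M) (g k : ℕ) (e : Entry N M) : Prop where
  groups_nodup : e.groups.Nodup
  groups_subset : ∀ j ∈ e.groups, j ∈ S
  groups_length_le : e.groups.length ≤ g
  batches_length : e.batches.length = e.groups.length
  elems_nodup : e.batches.flatten.Nodup
  elems_length_le : e.batches.flatten.length ≤ k
  elems_covered : ∀ i ∈ e.batches.flatten, ∃ j ∈ e.groups, i ∈ 𝔊.group j
  allowed : ∀ j ∈ e.groups, I j ≠ 0
  val_eq : e.val = (e.batches.flatten.map fun i => x i ^ 2).sum

/-- A selection of groups from `S` and elements in accordance with the assignment `I`, in which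
every group has an element that lies in no other group of the selection. -/
structure IsCompetitor (𝔊 : GroupStructure N M) (S : Finset (Fin M)) (I : Assignment M) (g k : ℕ)
    (W : Finset (Fin M)) (Y : Finset (Fin N)) : Prop where
  subset : W ⊆ S
  card_groups_le : W.card ≤ g
  card_elems_le : Y.card ≤ k
  covered : ∀ i ∈ Y, ∃ j ∈ W, i ∈ 𝔊.group j
  irredundant : ∀ j ∈ W, ∃ i ∈ Y, ∀ j' ∈ W, i ∈ 𝔊.group j' → j' = j
  selected : ∀ j, I j = 1 → j ∈ W
  allowed : ∀ j ∈ W, I j ≠ 0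

/-- A selection that is at least as good as all its competitors. -/
structure IsBest (𝔊 : GroupStructure N M) (x : Fin N → ℝ) (S : Finset (Fin M)) (I : Assignment M)
    (g k : ℕ) (e : Entry N M) : Prop extends 𝔊.IsSelection x S I g k e where
  le_val : ∀ W Y, 𝔊.IsCompetitor S I g k W Y → ∑ i ∈ Y, x i ^ 2 ≤ e.val

/-- The table has the best entry for every assignment on the nodes of `B`. -/
def TableCorrect (𝔊 : GroupStructure N M) (x : Fin N → ℝ) (G K : ℕ) (S : Finset (Fin M))
    (B : List (Fin M)) (F : Table N M) : Prop :=
  ∀ I ∈ assignments B, ∀ g ≤ G, ∀ k ≤ K, 𝔊.IsBest x S I g k (readEntry F I g k).ret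

theorem IsCompetitor.elems_eq_empty {S : Finset (Fin M)} {I : Assignment M} {g k : ℕ}
    {W : Finset (Fin M)} {Y : Finset (Fin N)} (h : 𝔊.IsCompetitor S I g k W Y)
    (hW : W = ∅) : Y = ∅ := by
  subst hW
  refine Finset.eq_empty_of_forall_notMem fun i hi => ?_
  obtain ⟨j, hj, -⟩ := h.covered i hi
  simp at hj

theorem isBest_emptyEntry {S : Finset (Fin M)} {I : Assignment M} {g k : ℕ}
    (h : S = ∅ ∨ g = 0 ∨ k = 0) : 𝔊.IsBest x S I g k emptyEntry where
  groups_nodup := by simp [emptyEntry]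
  groups_subset := by simp [emptyEntry]
  groups_length_le := by simp [emptyEntry]
  batches_length := by simp [emptyEntry]
  elems_nodup := by simp [emptyEntry]
  elems_length_le := by simp [emptyEntry]
  elems_covered := by simp [emptyEntry]
  allowed := by simp [emptyEntry]
  val_eq := by simp [emptyEntry]
  le_val W Y hWY := by
    have hY : Y = ∅ := by
      rcases h with rfl | rfl | rfl
      · exact hWY.elems_eq_empty (Finset.subset_empty.1 hWY.subset)
      · exact hWY.elems_eq_empty (Finset.card_eq_zero.1 (Nat.le_zero.1 hWY.card_groups_le))
      · exact Finset.card_eq_zero.1 (Nat.le_zero.1 hWY.card_elems_le)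
    simp [hY, emptyEntry]

/-- All writes to a given position write the same value, so later or repeated writes are harmless,
and the loops reach every position in range. -/
theorem fillTable_apply {G K : ℕ} {B : List (Fin M)}
    {f : Assignment M → ℕ → ℕ → Timed (Entry N M)} {I : Assignment M} (hI : I ∈ assignments B)
    {g : ℕ} (hg₁ : 1 ≤ g) (hg : g ≤ G) {k : ℕ} (hk₁ : 1 ≤ k) (hk : k ≤ K) :
    (fillTable G K B f).ret I g k = (f I g k).ret := by
  have write_self : ∀ (F : Table N M) I g k e, (writeEntry F I g k e).ret I g k = e := by
    intro F I g k e
    simp [writeEntry]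
  have write_correct : ∀ (F : Table N M) I' g' k', F I g k = (f I g k).ret →
      (writeEntry F I' g' k' (f I' g' k').ret).ret I g k = (f I g k).ret := by
    intro F I' g' k' h
    by_cases hI' : I = I'
    · subst hI'
      by_cases hg' : g = g'
      · subst hg'
        by_cases hk' : k = k'
        · subst hk'
          exact write_self _ _ _ _ _
        · simp [writeEntry, hk', h]
      · simp [writeEntry, hg', h]
    · simp [writeEntry, hI', h]
  have preserve : ∀ {α : Type} (l : List α) (step : Table N M → α → Table N M),
      (∀ F a, F I g k = (f I g k).ret → step F a I g k = (f I g k).ret) →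
      ∀ F : Table N M, F I g k = (f I g k).ret → l.foldl step F I g k = (f I g k).ret := by
    intro α l step hstep
    induction l with
    | nil => exact fun _ h => h
    | cons a l ih => exact fun F h => ih _ (hstep F a h)
  simp only [fillTable, ret_foldl, ret_bind]
  refine List.foldl_establishes (P := fun F : Table N M => F I g k = (f I g k).ret) ?_ hI ?_ _
  · exact fun F I' hF => preserve _ _ (fun F g' hF => preserve _ _
      (fun F k' hF => write_correct _ _ _ _ hF) F hF) F hF
  intro F
  refine List.foldl_establishes (P := fun F : Table N M => F I g k = (f I g k).ret) (a := g) ?_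
    (by rw [List.mem_range'_1]; omega) ?_ _
  · exact fun F g' hF => preserve _ _ (fun F k' hF => write_correct _ _ _ _ hF) F hF
  intro F
  refine List.foldl_establishes (P := fun F : Table N M => F I g k = (f I g k).ret) (a := k) ?_
    (by rw [List.mem_range'_1]; omega) ?_ _
  · exact fun F k' hF => write_correct _ _ _ _ hF
  · exact fun F => write_self _ _ _ _ _

theorem tableCorrect_fillTable {G K : ℕ} {S : Finset (Fin M)} {B : List (Fin M)}
    {f : Assignment M → ℕ → ℕ → Timed (Entry N M)}
    (h : ∀ I ∈ assignments B, ∀ g, 1 ≤ g → g ≤ G → ∀ k, 1 ≤ k → k ≤ K →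
      𝔊.IsBest x S I g k (f I g k).ret) :
    𝔊.TableCorrect x G K S B (fillTable G K B f).ret := by
  intro I hI g hg k hk
  simp only [readEntry, ret_bind, ret_pure]
  split_ifs with h0
  · exact isBest_emptyEntry (Or.inr h0)
  · rw [fillTable_apply hI (by omega) hg (by omega) hk]
    exact h I hI g (by omega) hg k (by omega) hk

theorem better_ret (a b : Entry N M) :
    ((better a b).ret = a ∨ (better a b).ret = b) ∧
      a.val ≤ (better a b).ret.val ∧ b.val ≤ (better a b).ret.val := by
  simp only [better, ret_bind, ret_pure]
  split_ifs with h
  · exact ⟨Or.inr rfl, h.le, le_rfl⟩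
  · exact ⟨Or.inl rfl, le_rfl, not_lt.1 h⟩

/-! ### Condensation -/

theorem isSelection_of_update {S : Finset (Fin M)} {I : Assignment M} {j : Fin M} (hj : I j ≠ 0)
    {b : Fin 3} {g k : ℕ} {e : Entry N M}
    (h : 𝔊.IsSelection x S (Function.update I j b) g k e) : 𝔊.IsSelection x S I g k e :=
  { h with
    allowed := fun i hi => by
      by_cases hij : i = j
      · rwa [hij]
      · have := h.allowed i hi
        rwa [Function.update_of_ne hij] at this }

/-- A competitor either contains `j` or does not, so it competes against one of the two entries.
Conversely, both entries stay valid when the restriction on `j` is lifted. -/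
theorem isBest_better {S : Finset (Fin M)} {I : Assignment M} {j : Fin M} (hj : I j = 2)
    {g k : ℕ} {e₀ e₁ : Entry N M} (h₀ : 𝔊.IsBest x S (Function.update I j 0) g k e₀)
    (h₁ : 𝔊.IsBest x S (Function.update I j 1) g k e₁) :
    𝔊.IsBest x S I g k (better e₀ e₁).ret := by
  obtain ⟨hor, hle₀, hle₁⟩ := better_ret e₀ e₁
  have hj0 : I j ≠ 0 := by simp [hj]
  refine ⟨?_, fun W Y hWY => ?_⟩
  · rcases hor with h | h <;> rw [h]
    · exact isSelection_of_update hj0 h₀.toIsSelection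
    · exact isSelection_of_update hj0 h₁.toIsSelection
  · have key : ∀ b : Fin 3, (b = 1 → j ∈ W) → (b = 0 → j ∉ W) →
        𝔊.IsCompetitor S (Function.update I j b) g k W Y := fun b hb₁ hb₀ =>
      { hWY with
        selected := fun i hi => by
          by_cases hij : i = j
          · subst hij
            exact hb₁ (by simpa using hi)
          · exact hWY.selected i (by rwa [Function.update_of_ne hij] at hi)
        allowed := fun i hi => by
          by_cases hij : i = j
          · subst hij
            rw [Function.update_self]
            exact fun h => hb₀ h hi
          · rw [Function.update_of_ne hij]
            exact hWY.allowed i hi }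
    by_cases hjW : j ∈ W
    · exact (h₁.le_val W Y (key 1 (fun _ => hjW) (by simp))).trans hle₁
    · exact (h₀.le_val W Y (key 0 (by simp) fun _ => hjW)).trans hle₀

theorem update_mem_assignments {B : List (Fin M)} {j : Fin M} (hj : j ∈ B)
    {I : Assignment M} (hI : I ∈ assignments (B.erase j)) {b : Fin 3} (hb : b ≠ 2) :
    Function.update I j b ∈ assignments B := by
  rw [mem_assignments] at hI ⊢
  refine ⟨fun i hi => ?_, fun i hi => ?_⟩
  · by_cases hij : i = j
    · rwa [hij, Function.update_self]
    · rw [Function.update_of_ne hij]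
      exact hI.1 i ((List.mem_erase_of_ne hij).2 hi)
  · have hij : i ≠ j := by
      rintro rfl
      exact hi hj
    rw [Function.update_of_ne hij]
    exact hI.2 i fun h => hi (List.mem_of_mem_erase h)

theorem tableCorrect_condense {G K : ℕ} {S : Finset (Fin M)} {B : List (Fin M)} {F : Table N M}
    (hB : B.Nodup) {j : Fin M} (hj : j ∈ B) (hF : 𝔊.TableCorrect x G K S B F) :
    𝔊.TableCorrect x G K S (B.erase j) (condense G K (B, F) j).ret.2 := by
  simp only [condense, ret_bind, ret_pure]
  refine tableCorrect_fillTable fun I hI g _ hg k _ hk => ?_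
  have hIj : I j = 2 := (mem_assignments.1 hI).2 j hB.not_mem_erase
  exact isBest_better hIj (hF _ (update_mem_assignments hj hI (by simp)) g hg k hk)
    (hF _ (update_mem_assignments hj hI (by simp)) g hg k hk)

/-! ### Accepting a node -/

/-- The `l` heaviest elements are at least as good as any other `l` elements. -/
theorem sum_le_sum_take {α : Type*} [DecidableEq α] {w : α → ℝ} (hw : ∀ a, 0 ≤ w a) (L : List α)
    (hL : L.Pairwise fun b c => w c ≤ w b) (l : ℕ) (Y : Finset α) (hY : ∀ a ∈ Y, a ∈ L)
    (hcard : Y.card ≤ l) : ∑ a ∈ Y, w a ≤ ((L.take l).map w).sum := by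
  induction L generalizing l Y with
  | nil =>
    have hempty : Y = ∅ := Finset.eq_empty_of_forall_notMem fun a ha => by simpa using hY a ha
    simp [hempty]
  | cons b L ih =>
    rw [List.pairwise_cons] at hL
    rcases l with - | l
    · rw [Finset.card_eq_zero.1 (Nat.le_zero.1 hcard)]
      simp
    · rw [List.take_succ_cons, List.map_cons, List.sum_cons]
      rcases Y.eq_empty_or_nonempty with rfl | hne
      · have : 0 ≤ ((L.take l).map w).sum := List.sum_nonneg fun r hr => by
          obtain ⟨a, -, rfl⟩ := List.mem_map.1 hr
          exact hw a
        simpa using add_nonneg (hw b) this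
      -- Exchange argument: the heaviest element `b` is matched with itself if it is in `Y`, and
      -- otherwise with any element of `Y`.
      · obtain ⟨a, ha, hab, hrest⟩ : ∃ a ∈ Y, w a ≤ w b ∧ ∀ c ∈ Y.erase a, c ∈ L := by
          by_cases hb : b ∈ Y
          · refine ⟨b, hb, le_rfl, fun c hc => ?_⟩
            rw [Finset.mem_erase] at hc
            exact (List.mem_cons.1 (hY c hc.2)).resolve_left hc.1
          · have hYL : ∀ c ∈ Y, c ∈ L := fun c hc =>
              (List.mem_cons.1 (hY c hc)).resolve_left fun h => hb (h ▸ hc)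
            obtain ⟨a, ha⟩ := hne
            exact ⟨a, ha, hL.1 a (hYL a ha), fun c hc => hYL c (Finset.mem_of_mem_erase hc)⟩
        rw [← Finset.add_sum_erase _ _ ha]
        refine add_le_add hab (ih hL.2 l _ hrest ?_)
        rw [Finset.card_erase_of_mem ha]
        omega

theorem mem_cleaned {B : List (Fin M)} {I : Assignment M} {v : Fin M} {i : Fin N} :
    i ∈ (𝔊.cleaned B I v).ret ↔ i ∈ 𝔊.group v ∧ ∀ j ∈ B, I j = 1 → i ∉ 𝔊.group j := by
  simp [cleaned, ret_filter]

theorem nodup_cleaned {B : List (Fin M)} {I : Assignment M} {v : Fin M} :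
    (𝔊.cleaned B I v).ret.Nodup := by
  rw [cleaned, ret_filter]
  exact (List.nodup_finRange N).filter _

theorem heaviest_spec (B : List (Fin M)) (I : Assignment M) (v : Fin M) (l : ℕ) :
    (𝔊.heaviest x B I v l).ret.2.Nodup ∧ (𝔊.heaviest x B I v l).ret.2.length ≤ l ∧
      (∀ i ∈ (𝔊.heaviest x B I v l).ret.2, i ∈ (𝔊.cleaned B I v).ret) ∧
      (𝔊.heaviest x B I v l).ret.1 = ((𝔊.heaviest x B I v l).ret.2.map fun i => x i ^ 2).sum ∧
      ∀ Y : Finset (Fin N), (∀ i ∈ Y, i ∈ (𝔊.cleaned B I v).ret) → Y.card ≤ l →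
        ∑ i ∈ Y, x i ^ 2 ≤ (𝔊.heaviest x B I v l).ret.1 := by
  simp only [heaviest, ret_bind, ret_pure]
  have hperm := sortDesc_perm (fun i => x i ^ 2) (𝔊.cleaned B I v).ret
  refine ⟨(hperm.nodup_iff.2 nodup_cleaned).sublist (List.take_sublist _ _), by simp,
    fun i hi => hperm.subset (List.mem_of_mem_take hi), trivial, fun Y hY hcard => ?_⟩
  exact sum_le_sum_take (w := fun i => x i ^ 2) (fun i => sq_nonneg _) _ (sortDesc_pairwise _ _)
    l Y (fun i hi => hperm.mem_iff.2 (hY i hi)) hcard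

theorem accept_ret (c : CostModel) (B : List (Fin M)) (F : Table N M) (v : Fin M)
    (I : Assignment M) (g : ℕ) {k : ℕ} (hk : 1 ≤ k) :
    (∃ l, 1 ≤ l ∧ l ≤ k ∧
      (𝔊.accept c x B F v I g k).ret = (𝔊.candidate c x B F v I g k l).ret) ∧
    ∀ l, 1 ≤ l → l ≤ k →
      (𝔊.candidate c x B F v I g k l).ret.val ≤ (𝔊.accept c x B F v I g k).ret.val := by
  set f : ℕ → Entry N M := fun l => (𝔊.candidate c x B F v I g k l).ret with hf
  have hfold : ∀ (ls : List ℕ) (e : Entry N M),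
      (ls.foldl (fun a l => (better a (f l)).ret) e = e ∨
        ∃ l ∈ ls, ls.foldl (fun a l => (better a (f l)).ret) e = f l) ∧
      e.val ≤ (ls.foldl (fun a l => (better a (f l)).ret) e).val ∧
      ∀ l ∈ ls, (f l).val ≤ (ls.foldl (fun a l => (better a (f l)).ret) e).val := by
    intro ls
    induction ls with
    | nil => intro e; simp
    | cons l ls ih =>
      intro e
      obtain ⟨h₁, h₂, h₃⟩ := ih (better e (f l)).ret
      obtain ⟨h₄, h₅, h₆⟩ := better_ret e (f l)
      rw [List.foldl_cons]
      refine ⟨?_, h₅.trans h₂, ?_⟩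
      · rcases h₁ with h | ⟨l', hl', h⟩
        · rcases h₄ with h' | h'
          · exact Or.inl (h.trans h')
          · exact Or.inr ⟨l, by simp, h.trans h'⟩
        · exact Or.inr ⟨l', by simp [hl'], h⟩
      · intro l' hl'
        rcases List.mem_cons.1 hl' with rfl | hl'
        · exact h₆.trans h₂
        · exact h₃ l' hl'
  have hret : (𝔊.accept c x B F v I g k).ret =
      (List.range' 2 (k - 1)).foldl (fun a l => (better a (f l)).ret) (f 1) := by
    simp only [accept, ret_bind, ret_foldl]
    rfl
  obtain ⟨h₁, h₂, h₃⟩ := hfold (List.range' 2 (k - 1)) (f 1)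
  rw [← hret] at h₁ h₂ h₃
  refine ⟨?_, fun l hl₁ hl => ?_⟩
  · rcases h₁ with h | ⟨l, hl, h⟩
    · exact ⟨1, le_rfl, hk, h⟩
    · rw [List.mem_range'_1] at hl
      exact ⟨l, by omega, by omega, h⟩
  · rcases eq_or_lt_of_le hl₁ with rfl | hl₁
    · exact h₂
    · exact h₃ l (by rw [List.mem_range'_1]; omega)

theorem candidate_ret (c : CostModel) (B : List (Fin M)) (F : Table N M) (v : Fin M)
    (I : Assignment M) (g k l : ℕ) :
    (𝔊.candidate c x B F v I g k l).ret =
      ⟨(readEntry F I (g - 1) (k - l)).ret.val + (𝔊.heaviest x B I v l).ret.1,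
        v :: (readEntry F I (g - 1) (k - l)).ret.groups,
        (𝔊.heaviest x B I v l).ret.2 :: (readEntry F I (g - 1) (k - l)).ret.batches⟩ := by
  simp [candidate]

section Extend

variable {G K : ℕ} {S : Finset (Fin M)} {B : List (Fin M)} {F : Table N M} {v : Fin M}
  {I J : Assignment M} {g k : ℕ}

/-- An old element shared with `v` would be covered by a used group adjacent to `v`. By `hB` that
group is in `B`; it is not forbidden, hence assigned `1`, and cleaning has removed its elements from
`v`. -/
theorem isSelection_candidate (c : CostModel) (hv : v ∉ S)
    (hB : ∀ j ∈ S, 𝔊.groupGraph.Adj v j → j ∈ B) (hI : I ∈ assignments B)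
    (hIJ : ∀ j, j ≠ v → I j = J j) (hJv : J v ≠ 0) (hg : 1 ≤ g) {l : ℕ} (hl : l ≤ k)
    (hF : 𝔊.IsSelection x S I (g - 1) (k - l) (readEntry F I (g - 1) (k - l)).ret) :
    𝔊.IsSelection x (insert v S) J g k (𝔊.candidate c x B F v I g k l).ret := by
  obtain ⟨h₁, h₂, h₃, h₄, -⟩ := 𝔊.heaviest_spec (x := x) B I v l
  rw [candidate_ret]
  set e := (readEntry F I (g - 1) (k - l)).ret
  have hve : v ∉ e.groups := fun h => hv (hF.groups_subset v h)
  refine ⟨List.nodup_cons.2 ⟨hve, hF.groups_nodup⟩, ?_, ?_, ?_, ?_, ?_, ?_, ?_, ?_⟩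
  · intro j hj
    rcases List.mem_cons.1 hj with rfl | hj
    · exact Finset.mem_insert_self _ _
    · exact Finset.mem_insert_of_mem (hF.groups_subset j hj)
  · have := hF.groups_length_le
    simp only [List.length_cons]
    omega
  · simp [hF.batches_length]
  · rw [List.flatten_cons, List.nodup_append']
    refine ⟨h₁, hF.elems_nodup, fun i hi hi' => ?_⟩
    obtain ⟨j, hj, hij⟩ := hF.elems_covered i hi'
    obtain ⟨hiv, hcl⟩ := mem_cleaned.1 (h₃ i hi)
    have hjB : j ∈ B := hB j (hF.groups_subset j hj)
      ⟨fun h => hve (h ▸ hj), i, Finset.mem_inter.2 ⟨hiv, hij⟩⟩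
    have hj0 := hF.allowed j hj
    have hj2 := (mem_assignments.1 hI).1 j hjB
    exact hcl j hjB (by omega) hij
  · have := hF.elems_length_le
    simp only [List.flatten_cons, List.length_append]
    omega
  · intro i hi
    rw [List.flatten_cons, List.mem_append] at hi
    rcases hi with hi | hi
    · exact ⟨v, by simp, (mem_cleaned.1 (h₃ i hi)).1⟩
    · obtain ⟨j, hj, hij⟩ := hF.elems_covered i hi
      exact ⟨j, List.mem_cons_of_mem _ hj, hij⟩
  · intro j hj
    rcases List.mem_cons.1 hj with rfl | hj
    · exact hJv
    · rw [← hIJ j fun h => hve (h ▸ hj)]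
      exact hF.allowed j hj
  · simp only [List.flatten_cons, List.map_append, List.sum_append]
    rw [hF.val_eq, h₄, add_comm]

/-- The witness `l` is the number of elements that only `v` covers. It is positive because `v` has a
private element. These elements survive cleaning, since the groups assigned `1` belong to `W`. The
private elements of the other groups all stay in the remaining part, so `W.erase v` is again a
competitor. -/
theorem exists_candidate_ge (c : CostModel) (hg₁ : 1 ≤ g)
    (hIJ : ∀ j, j ≠ v → I j = J j) (hIv : I v = 2) (hJv : J v = 1)
    (hF : ∀ l, 1 ≤ l → l ≤ k →
      𝔊.IsBest x S I (g - 1) (k - l) (readEntry F I (g - 1) (k - l)).ret)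
    {W : Finset (Fin M)} {Y : Finset (Fin N)}
    (h : 𝔊.IsCompetitor (insert v S) J g k W Y) :
    ∃ l, 1 ≤ l ∧ l ≤ k ∧
      ∑ i ∈ Y, x i ^ 2 ≤ (𝔊.candidate c x B F v I g k l).ret.val := by
  classical
  have hvW : v ∈ W := h.selected v hJv
  set Y₁ := Y.filter fun i => ∃ j ∈ W.erase v, i ∈ 𝔊.group j with hY₁
  set Y₂ := Y.filter fun i => ¬ ∃ j ∈ W.erase v, i ∈ 𝔊.group j with hY₂
  have hsum : ∑ i ∈ Y₁, x i ^ 2 + ∑ i ∈ Y₂, x i ^ 2 = ∑ i ∈ Y, x i ^ 2 :=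
    Finset.sum_filter_add_sum_filter_not _ _ _
  have hcard : Y₁.card + Y₂.card = Y.card := Finset.card_filter_add_card_filter_not _
  have hpos : 1 ≤ Y₂.card := by
    obtain ⟨i, hi, hi'⟩ := h.irredundant v hvW
    refine Finset.card_pos.2 ⟨i, Finset.mem_filter.2 ⟨hi, ?_⟩⟩
    rintro ⟨j, hj, hij⟩
    rw [Finset.mem_erase] at hj
    exact hj.1 (hi' j hj.2 hij)
  have hYk := h.card_elems_le
  refine ⟨Y₂.card, hpos, by omega, ?_⟩
  rw [candidate_ret, ← hsum]
  have hWg := h.card_groups_le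
  refine add_le_add ((hF _ hpos (by omega)).le_val (W.erase v) Y₁ ?_)
    ((𝔊.heaviest_spec (x := x) B I v Y₂.card).2.2.2.2 Y₂ ?_ le_rfl)
  · refine ⟨fun j hj => ?_, ?_, by omega, ?_, ?_, ?_, ?_⟩
    · rw [Finset.mem_erase] at hj
      exact (Finset.mem_insert.1 (h.subset hj.2)).resolve_left hj.1
    · rw [Finset.card_erase_of_mem hvW]
      omega
    · exact fun i hi => (Finset.mem_filter.1 hi).2
    · intro j hj
      have hj' := Finset.mem_erase.1 hj
      obtain ⟨i, hi, hi'⟩ := h.irredundant j hj'.2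
      obtain ⟨j', hj₁, hj₂⟩ := h.covered i hi
      rw [hi' j' hj₁ hj₂] at hj₂
      exact ⟨i, Finset.mem_filter.2 ⟨hi, j, hj, hj₂⟩,
        fun j'' hj'' => hi' j'' (Finset.mem_of_mem_erase hj'')⟩
    · intro j hj
      have hjv : j ≠ v := by
        rintro rfl
        rw [hIv] at hj
        exact absurd hj (by decide)
      exact Finset.mem_erase.2 ⟨hjv, h.selected j (hIJ j hjv ▸ hj)⟩
    · intro j hj
      rw [Finset.mem_erase] at hj
      rw [hIJ j hj.1]
      exact h.allowed j hj.2
  · intro i hi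
    obtain ⟨hiY, hi'⟩ := Finset.mem_filter.1 hi
    rw [mem_cleaned]
    constructor
    · obtain ⟨j, hj, hij⟩ := h.covered i hiY
      by_cases hjv : j = v
      · exact hjv ▸ hij
      · exact absurd ⟨j, Finset.mem_erase.2 ⟨hjv, hj⟩, hij⟩ hi'
    · intro j _ hj hij
      have hjv : j ≠ v := by
        rintro rfl
        rw [hIv] at hj
        exact absurd hj (by decide)
      exact hi' ⟨j, Finset.mem_erase.2 ⟨hjv, h.selected j (hIJ j hjv ▸ hj)⟩, hij⟩

theorem tableCorrect_extend (c : CostModel) (hv : v ∉ S) (hBS : ∀ j ∈ B, j ∈ S)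
    (hB : ∀ j ∈ S, 𝔊.groupGraph.Adj v j → j ∈ B) (hF : 𝔊.TableCorrect x G K S B F) :
    𝔊.TableCorrect x G K (insert v S) (v :: B) (𝔊.extend c x G K B F v).ret := by
  refine tableCorrect_fillTable fun J hJ g hg₁ hg k hk₁ hk => ?_
  have hvB : v ∉ B := fun h => hv (hBS v h)
  rw [mem_assignments] at hJ
  -- The old table has no coordinate for `v`; it is read with `v` unrestricted.
  set I := Function.update J v 2 with hIdef
  have hIJ : ∀ j, j ≠ v → I j = J j := fun j hj => Function.update_of_ne hj _ _
  have hIv : I v = 2 := Function.update_self ..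
  have hI : I ∈ assignments B := by
    rw [mem_assignments]
    refine ⟨fun j hj => ?_, fun j hj => ?_⟩
    · rw [hIJ j fun h => hvB (h ▸ hj)]
      exact hJ.1 j (List.mem_cons_of_mem _ hj)
    · by_cases hjv : j = v
      · rw [hjv, hIv]
      · rw [hIJ j hjv]
        exact hJ.2 j (by simp [hjv, hj])
  split_ifs with hJv
  -- Rejection: a competitor for `J` omits `v`, so it already lives on `S`.
  · have h := hF I hI g hg k hk
    refine ⟨{ h.toIsSelection with
      groups_subset := fun j hj => Finset.mem_insert_of_mem (h.groups_subset j hj)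
      allowed := fun j hj => ?_ }, fun W Y hWY => h.le_val W Y { hWY with
        subset := fun j hj => ?_
        selected := fun j hj => hWY.selected j ?_
        allowed := fun j hj => ?_ }⟩
    · rw [← hIJ j fun h' => hv (h' ▸ h.groups_subset j hj)]
      exact h.allowed j hj
    · refine (Finset.mem_insert.1 (hWY.subset hj)).resolve_left ?_
      rintro rfl
      exact hWY.allowed j hj hJv
    · rw [← hIJ j ?_]
      · exact hj
      · rintro rfl
        rw [hIv] at hj
        exact absurd hj (by decide)
    · rw [hIJ j fun h' => hWY.allowed j hj (h' ▸ hJv)]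
      exact hWY.allowed j hj
  · have hJv1 : J v = 1 := by
      have := hJ.1 v (by simp)
      omega
    obtain ⟨⟨l, -, hl, hret⟩, hmax⟩ := 𝔊.accept_ret (x := x) c B F v I g hk₁
    refine ⟨?_, fun W Y hWY => ?_⟩
    · rw [hret]
      exact isSelection_candidate c hv hB hI hIJ hJv hg₁ hl
        (hF I hI (g - 1) (by omega) (k - l) (by omega)).toIsSelection
    · obtain ⟨l, hl₁, hl, hle⟩ := exists_candidate_ge c hg₁ hIJ hIv hJv1
        (fun l _ _ => hF I hI (g - 1) (by omega) (k - l) (by omega)) hWY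
      exact hle.trans (hmax l hl₁ hl)

end Extend

end GroupStructure

/-- `Timed.foldl_amortized` with an invariant that refers to the list of the items treated so
far. -/
theorem Timed.foldl_amortized_prefix {α σ : Type} (f : σ → α → Timed σ) (P : List α → σ → Prop)
    (Φ : σ → ℕ) (c : ℕ) (l pre : List α)
    (h : ∀ pre' a suf, pre ++ l = pre' ++ a :: suf → ∀ s, P pre' s →
      P (pre' ++ [a]) (f s a).ret ∧ (f s a).time + Φ (f s a).ret ≤ c + Φ s)
    (s : σ) (hs : P pre s) :
    P (pre ++ l) (foldl f s l).ret ∧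
      (foldl f s l).time + Φ (foldl f s l).ret ≤ l.length * (c + 1) + Φ s := by
  induction l generalizing s pre with
  | nil => simpa [foldl] using hs
  | cons a l ih =>
    obtain ⟨h₁, h₂⟩ := h pre a l rfl s hs
    obtain ⟨h₃, h₄⟩ := ih (pre ++ [a]) (by simpa using h) _ h₁
    refine ⟨by simpa [foldl] using h₃, ?_⟩
    simp only [foldl, time_bind, time_tick, ret_bind, List.length_cons] at h₄ ⊢
    linarith

theorem List.foldl_update_apply {α β : Type*} [DecidableEq α] (p : α → Bool) (h : β → β)
    (l : List α) (hl : l.Nodup) (r : α → β) (u : α) :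
    l.foldl (fun r u => if p u then Function.update r u (h (r u)) else r) r u =
      if u ∈ l ∧ p u then h (r u) else r u := by
  induction l generalizing r with
  | nil => simp
  | cons a l ih =>
    rw [List.nodup_cons] at hl
    rw [List.foldl_cons, ih hl.2]
    by_cases hua : u = a
    · subst hua
      cases hp : p u <;> simp [hl.1]
    · cases hp : p a <;> simp [hua]

/-! ### The state of the dynamic program and the cost of exploring a node -/

namespace GroupStructure

open Timed

variable {N M : ℕ} {𝔊 : GroupStructure N M} {x : Fin N → ℝ}

open Classical in
/-- The unexplored neighbours of a node. -/
noncomputable def unexploredNeighbors (𝔊 : GroupStructure N M) (S : Finset (Fin M)) (u : Fin M) :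
    Finset (Fin M) :=
  Finset.univ.filter fun w => w ∉ S ∧ 𝔊.groupGraph.Adj w u

theorem mem_unexploredNeighbors {S : Finset (Fin M)} {u w : Fin M} :
    w ∈ 𝔊.unexploredNeighbors S u ↔ w ∉ S ∧ 𝔊.groupGraph.Adj w u := by
  simp [unexploredNeighbors]

theorem card_unexploredNeighbors_insert {S : Finset (Fin M)} {v : Fin M} (hv : v ∉ S)
    (u : Fin M) : (𝔊.unexploredNeighbors (insert v S) u).card =
      if (𝔊.adjacent v u).ret then (𝔊.unexploredNeighbors S u).card - 1
      else (𝔊.unexploredNeighbors S u).card := by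
  split_ifs with h <;> rw [adjacent_ret] at h
  · rw [← Finset.card_erase_of_mem (mem_unexploredNeighbors.2 ⟨hv, h⟩)]
    congr 1
    ext w
    simp only [Finset.mem_erase, mem_unexploredNeighbors, Finset.mem_insert]
    tauto
  · congr 1
    ext w
    simp only [mem_unexploredNeighbors, Finset.mem_insert]
    refine ⟨by tauto, fun hw => ⟨?_, hw.2⟩⟩
    rintro (rfl | hwS)
    exacts [h hw.2, hw.1 hwS]

/-- The state of the dynamic program after the nodes of `S` have been explored. -/
structure StateCorrect (𝔊 : GroupStructure N M) (x : Fin N → ℝ) (G K : ℕ) (S : Finset (Fin M))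
    (s : DPState N M) : Prop where
  unexplored_eq : ∀ u, s.unexplored u = (𝔊.unexploredNeighbors S u).card
  nodup : s.bdry.Nodup
  mem_bdry : ∀ j, j ∈ s.bdry ↔ j ∈ 𝔊.boundary S
  table : 𝔊.TableCorrect x G K S s.bdry s.table

theorem StateCorrect.length_bdry {G K : ℕ} {S : Finset (Fin M)} {s : DPState N M}
    (h : 𝔊.StateCorrect x G K S s) : s.bdry.length = (𝔊.boundary S).card := by
  rw [← List.toFinset_card_of_nodup h.nodup]
  congr 1
  ext j
  rw [List.mem_toFinset, h.mem_bdry]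

/-! ### Running times -/

theorem time_fillTable_le {G K : ℕ} (hG : 1 ≤ G) (hK : 1 ≤ K) {B : List (Fin M)}
    {f : Assignment M → ℕ → ℕ → Timed (Entry N M)} {t : ℕ}
    (hf : ∀ I g k, k ≤ K → (f I g k).time ≤ t) :
    (fillTable G K B f).time ≤ 2 ^ B.length * (G * K * (t + 4)) := by
  have h := time_foldl_le (fun F I =>
    Timed.foldl (fun F g =>
      Timed.foldl (fun F k => do
        let e ← f I g k
        writeEntry F I g k e) F (List.range' 1 K)) F (List.range' 1 G))
    (G * (K * (t + 2) + 1)) (assignments B) (fun F I _ => by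
      refine (time_foldl_le _ (K * (t + 2)) _ (fun F g _ => ?_) _).trans (by simp)
      refine (time_foldl_le _ (t + 1) _ (fun F k hk => ?_) _).trans (by simp [add_assoc])
      rw [List.mem_range'_1] at hk
      simpa [writeEntry] using hf I g k (by omega)) fun _ _ _ => emptyEntry
  refine h.trans ?_
  rw [length_assignments]
  refine Nat.mul_le_mul_left _ ?_
  have h₁ : G ≤ G * K := Nat.le_mul_of_pos_right _ hK
  have h₂ : 1 ≤ G * K := Nat.mul_pos hG hK
  nlinarith

theorem time_candidate_le {c : CostModel} {h : ℕ} {B : List (Fin M)}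
    (hh : ∀ I v l, (c.charge (𝔊.heaviest x B I v l)).time ≤ h) (F : Table N M) (v : Fin M)
    (I : Assignment M) (g k l : ℕ) : (𝔊.candidate c x B F v I g k l).time ≤ h + 2 := by
  have := hh I v l
  simp only [candidate, readEntry, time_bind, time_tick, time_pure]
  omega

theorem time_accept_le {c : CostModel} {h : ℕ} {B : List (Fin M)}
    (hh : ∀ I v l, (c.charge (𝔊.heaviest x B I v l)).time ≤ h) (F : Table N M) (v : Fin M)
    (I : Assignment M) (g k K : ℕ) (hk : k ≤ K) (hK : 1 ≤ K) :
    (𝔊.accept c x B F v I g k).time ≤ K * (h + 4) := by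
  have h₁ := time_candidate_le hh F v I g k 1
  have h₂ := time_foldl_le (fun a l => do
    let b ← 𝔊.candidate c x B F v I g k l
    better a b) (h + 3) (List.range' 2 (k - 1)) (fun a l _ => by
      have := time_candidate_le hh F v I g k l
      simp only [better, time_bind, time_tick, time_pure]
      omega) (𝔊.candidate c x B F v I g k 1).ret
  rw [List.length_range'] at h₂
  have h₃ : (k - 1) * (h + 3 + 1) ≤ (K - 1) * (h + 4) := Nat.mul_le_mul_right _ (by omega)
  obtain ⟨K, rfl⟩ := Nat.exists_eq_add_of_le' hK
  simp only [accept, time_bind]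
  rw [Nat.add_sub_cancel] at h₃
  linarith

theorem time_extend_le {c : CostModel} {h G K : ℕ} (hG : 1 ≤ G) (hK : 1 ≤ K) {B : List (Fin M)}
    (hh : ∀ I v l, (c.charge (𝔊.heaviest x B I v l)).time ≤ h) (F : Table N M) (v : Fin M) :
    (𝔊.extend c x G K B F v).time ≤ 2 ^ (B.length + 1) * (G * K * (K * (h + 4) + 4)) := by
  refine time_fillTable_le hG hK fun J g k hk => ?_
  split_ifs
  · simp only [readEntry, time_bind, time_tick, time_pure]
    have : 1 * 1 ≤ K * (h + 4) := Nat.mul_le_mul hK (by omega)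
    omega
  · exact time_accept_le hh F v _ g k K hk hK

theorem time_condense_le {G K : ℕ} (hG : 1 ≤ G) (hK : 1 ≤ K) (s : List (Fin M) × Table N M)
    (j : Fin M) {b : ℕ} (hs : s.1.length ≤ b) :
    (condense G K s j).time ≤ b + 2 ^ b * (G * K * 7) := by
  simp only [condense, time_bind, time_tick, time_pure]
  refine Nat.add_le_add hs ?_
  refine (time_fillTable_le hG hK (t := 3) fun I g k _ => ?_).trans ?_
  · simp [readEntry, better]
  · refine Nat.mul_le_mul_right _ (Nat.pow_le_pow_right (by norm_num) ?_)
    exact List.length_erase_le.trans hs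

/-- The length identity serves the amortized analysis: each condensation shortens the boundary list
by exactly one. -/
theorem foldl_condense_spec {G K : ℕ} {S : Finset (Fin M)} (l : List (Fin M)) (hl : l.Nodup)
    (s : List (Fin M) × Table N M) (hs : s.1.Nodup) (hls : ∀ j ∈ l, j ∈ s.1)
    (hF : 𝔊.TableCorrect x G K S s.1 s.2) :
    (Timed.foldl (condense G K) s l).ret.1.Nodup ∧
      (∀ j, j ∈ (Timed.foldl (condense G K) s l).ret.1 ↔ j ∈ s.1 ∧ j ∉ l) ∧
      (Timed.foldl (condense G K) s l).ret.1.length + l.length = s.1.length ∧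
      𝔊.TableCorrect x G K S (Timed.foldl (condense G K) s l).ret.1
        (Timed.foldl (condense G K) s l).ret.2 := by
  induction l generalizing s with
  | nil => simpa [Timed.foldl] using ⟨hs, hF⟩
  | cons a l ih =>
    rw [List.nodup_cons] at hl
    have ha := hls a (by simp)
    have hret : (condense G K s a).ret.1 = s.1.erase a := by simp [condense]
    have hmem : ∀ j, j ∈ s.1.erase a ↔ j ≠ a ∧ j ∈ s.1 := fun j => hs.mem_erase_iff
    obtain ⟨h₁, h₂, h₃, h₄⟩ := ih hl.2 (condense G K s a).ret (hret ▸ hs.erase a)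
      (fun j hj => by
        rw [hret, hmem]
        exact ⟨fun h => hl.1 (h ▸ hj), hls j (by simp [hj])⟩)
      (hret ▸ tableCorrect_condense hs ha hF)
    simp only [Timed.foldl, ret_bind]
    refine ⟨h₁, fun j => ?_, ?_, h₄⟩
    · rw [h₂, hret, hmem, List.mem_cons]
      tauto
    · rw [hret, List.length_erase_of_mem ha] at h₃
      have := List.length_pos_of_mem ha
      simp only [List.length_cons]
      omega

/-- With `T = M * G * K ^ 2 * Q`, updating the counters costs at most `2 * T`, extending the table
`40 * T`, finding the interior nodes `T`, and each condensation `30 * T`. Condensations are charged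
to the boundary nodes they remove; the potential of the new node `v` is `30 * T`, which gives `73 *
T` in total. -/
theorem explore_spec {c : CostModel} {Q G K : ℕ} (hG : 1 ≤ G) (hK : 1 ≤ K) (hQ : 1 ≤ Q)
    (ha : ∀ i j, (c.charge (𝔊.adjacent i j)).time ≤ Q)
    (hh : ∀ B : List (Fin M), B.length ≤ M → ∀ I v l,
      (c.charge (𝔊.heaviest x B I v l)).time ≤ 2 * Q)
    {S : Finset (Fin M)} (hS : 2 ^ (𝔊.boundary S).card ≤ M + 1) {v : Fin M} (hv : v ∉ S)
    {s : DPState N M} (hs : 𝔊.StateCorrect x G K S s) :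
    𝔊.StateCorrect x G K (insert v S) (𝔊.explore c x G K s v).ret ∧
      (𝔊.explore c x G K s v).time +
          30 * (M * G * K ^ 2 * Q) * (𝔊.explore c x G K s v).ret.bdry.length ≤
        73 * (M * G * K ^ 2 * Q) + 30 * (M * G * K ^ 2 * Q) * s.bdry.length := by
  have hM : 1 ≤ M := Fin.pos v
  have hvB : v ∉ s.bdry := fun h => hv ((𝔊.mem_boundary.1 ((hs.mem_bdry v).1 h)).1)
  have hnd : (v :: s.bdry).Nodup := List.nodup_cons.2 ⟨hvB, hs.nodup⟩
  have hlen : s.bdry.length + 1 ≤ M := by simpa using length_le_of_nodup hnd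
  set loop := Timed.foldl (fun r u => do
    let b ← c.charge (𝔊.adjacent v u)
    pure (if b then Function.update r u (r u - 1) else r)) s.unexplored (List.finRange M)
    with hloop
  set r := loop.ret with hr
  have hr_eq : ∀ u, r u = (𝔊.unexploredNeighbors (insert v S) u).card := by
    intro u
    rw [hr, hloop, ret_foldl]
    simp only [ret_bind, ret_pure, CostModel.ret_charge]
    rw [List.foldl_update_apply (fun u => (𝔊.adjacent v u).ret) (fun n => n - 1) _
      (List.nodup_finRange M), card_unexploredNeighbors_insert hv, hs.unexplored_eq]
    simp
  set interior := (v :: s.bdry).filter (fun j => decide (r j = 0)) with hint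
  have hF := tableCorrect_extend (x := x) c hv
    (fun j hj => (𝔊.mem_boundary.1 ((hs.mem_bdry j).1 hj)).1)
    (fun j hj hadj => (hs.mem_bdry j).2 (𝔊.mem_boundary.2 ⟨hj, v, hv, hadj.symm⟩)) hs.table
  obtain ⟨h₁, h₂, h₃, h₄⟩ := foldl_condense_spec interior (hnd.filter _)
    (v :: s.bdry, (𝔊.extend c x G K s.bdry s.table v).ret) hnd
    (fun j hj => (List.mem_filter.1 hj).1) hF
  have hret : (𝔊.explore c x G K s v).ret = ⟨r,
      (Timed.foldl (condense G K)
        (v :: s.bdry, (𝔊.extend c x G K s.bdry s.table v).ret) interior).ret.1,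
      (Timed.foldl (condense G K)
        (v :: s.bdry, (𝔊.extend c x G K s.bdry s.table v).ret) interior).ret.2⟩ := by
    simp only [explore, ret_bind, ret_pure, ret_filter]
    rfl
  have htime : (𝔊.explore c x G K s v).time = loop.time +
      ((𝔊.extend c x G K s.bdry s.table v).time +
      ((Timed.filter (fun j => pure (decide (r j = 0))) (v :: s.bdry)).time +
      (Timed.foldl (condense G K)
        (v :: s.bdry, (𝔊.extend c x G K s.bdry s.table v).ret) interior).time)) := by
    simp only [explore, ret_pure, ret_filter, time_bind, time_pure, Nat.add_zero]
    rfl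
  rw [hret, htime]
  constructor
  · refine ⟨hr_eq, h₁, fun j => ?_, h₄⟩
    rw [h₂, 𝔊.mem_boundary, hint, List.mem_filter, decide_eq_true_iff, hr_eq,
      Finset.card_eq_zero, ← Finset.not_nonempty_iff_eq_empty]
    have hne : (𝔊.unexploredNeighbors (insert v S) j).Nonempty ↔
        ∃ u, u ∉ insert v S ∧ 𝔊.groupGraph.Adj j u :=
      exists_congr fun u => by rw [mem_unexploredNeighbors, 𝔊.groupGraph.adj_comm]
    rw [hne, List.mem_cons, hs.mem_bdry, 𝔊.mem_boundary, Finset.mem_insert]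
    constructor
    · rintro ⟨hj, hj'⟩
      exact ⟨hj.imp_right fun h => h.1, by_contra fun h => hj' ⟨hj, h⟩⟩
    · rintro ⟨hj, u, hu, hadj⟩
      refine ⟨hj.imp_right fun h => ⟨h, u, fun hu' => hu (Finset.mem_insert_of_mem hu'), hadj⟩,
        fun h => h.2 ⟨u, hu, hadj⟩⟩
  · set T := M * G * K ^ 2 * Q with hT
    have hMT : M * Q ≤ T := by
      have : M * Q * 1 ≤ M * Q * (G * K ^ 2) :=
        Nat.mul_le_mul_left _ (Nat.mul_pos hG (pow_pos hK 2))
      rw [hT]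
      linarith
    have hMQ : M ≤ M * Q := Nat.le_mul_of_pos_right _ hQ
    -- From `2 ^ b ≤ M + 1`, doubled for the new node, with `1 ≤ M`.
    have hpow : 2 ^ (s.bdry.length + 1) ≤ 4 * M := by
      rw [pow_succ, hs.length_bdry]
      omega
    have t₁ : loop.time ≤ M * (Q + 1) := by
      simpa using time_foldl_le (fun r u => do
        let b ← c.charge (𝔊.adjacent v u)
        pure (if b then Function.update r u (r u - 1) else r)) Q (List.finRange M)
        (fun r u _ => by simpa using ha v u) s.unexplored
    have t₂ : (𝔊.extend c x G K s.bdry s.table v).time ≤ 40 * T := by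
      refine (time_extend_le hG hK (hh s.bdry (by omega)) _ _).trans ?_
      have hKQ : 1 ≤ K * Q := Nat.mul_pos hK hQ
      have hb : K * (2 * Q + 4) + 4 ≤ 10 * (K * Q) := by nlinarith
      calc 2 ^ (s.bdry.length + 1) * (G * K * (K * (2 * Q + 4) + 4))
          ≤ 4 * M * (G * K * (10 * (K * Q))) :=
            Nat.mul_le_mul hpow (Nat.mul_le_mul_left _ hb)
        _ = 40 * T := by rw [hT]; ring
    have t₃ : (Timed.filter (fun j => pure (decide (r j = 0))) (v :: s.bdry)).time ≤ M := by
      refine (time_filter_le _ 0 _ (by simp)).trans ?_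
      simpa using hlen
    have t₄ : (Timed.foldl (condense G K)
        (v :: s.bdry, (𝔊.extend c x G K s.bdry s.table v).ret) interior).time ≤
        interior.length * (30 * T) := by
      have hcost : s.bdry.length + 1 + 2 ^ (s.bdry.length + 1) * (G * K * 7) + 1 ≤ 30 * T := by
        have h28 : 2 ^ (s.bdry.length + 1) * (G * K * 7) ≤ 28 * T := by
          have hKQ : G * K * 7 ≤ 7 * (G * K) * (K * Q) := by
            have : 7 * (G * K) * 1 ≤ 7 * (G * K) * (K * Q) :=
              Nat.mul_le_mul_left _ (Nat.mul_pos hK hQ)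
            linarith
          calc 2 ^ (s.bdry.length + 1) * (G * K * 7) ≤ 4 * M * (7 * (G * K) * (K * Q)) :=
                Nat.mul_le_mul hpow hKQ
            _ = 28 * T := by rw [hT]; ring
        omega
      have h := (foldl_amortized (condense G K) (fun s' => s'.1.length ≤ s.bdry.length + 1)
        (fun _ => 0) (s.bdry.length + 1 + 2 ^ (s.bdry.length + 1) * (G * K * 7)) interior
        (fun s' j _ hs' => ⟨by simpa [condense] using List.length_erase_le.trans hs',
          by simpa using time_condense_le hG hK s' j hs'⟩)
        (v :: s.bdry, (𝔊.extend c x G K s.bdry s.table v).ret) (by simp)).2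
      exact (Nat.le_add_right _ _).trans (h.trans (Nat.mul_le_mul_left _ hcost))
    simp only [List.length_cons] at h₃
    have h₅ : 30 * T * (Timed.foldl (condense G K)
        (v :: s.bdry, (𝔊.extend c x G K s.bdry s.table v).ret) interior).ret.1.length +
        interior.length * (30 * T) = 30 * T * s.bdry.length + 30 * T := by
      rw [mul_comm interior.length, ← Nat.mul_add, h₃]
      ring
    have h₆ : M * (Q + 1) = M * Q + M := by ring
    linarith

theorem foldl_count_neighbors (l : List (Fin M)) (r : Fin M → ℕ) (u : Fin M) :
    l.foldl (fun r v => (List.finRange M).foldl (fun r u =>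
      if (𝔊.adjacent v u).ret then Function.update r u (r u + 1) else r) r) r u =
    r u + l.countP fun v => (𝔊.adjacent v u).ret := by
  induction l generalizing r with
  | nil => simp
  | cons v l ih =>
    rw [List.foldl_cons, ih, List.foldl_update_apply (fun u => (𝔊.adjacent v u).ret)
      (fun n => n + 1) _ (List.nodup_finRange M), List.countP_cons]
    cases h : (𝔊.adjacent v u).ret
    · simp
    · simp only [List.mem_finRange, true_and, if_true]
      omega

theorem stateCorrect_initialState (c : CostModel) (G K : ℕ) :
    𝔊.StateCorrect x G K ∅ (𝔊.initialState c G K).ret := by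
  refine ⟨fun u => ?_, by simp [initialState], by simp [initialState, boundary], ?_⟩
  · simp only [initialState, ret_bind, ret_pure, ret_foldl, CostModel.ret_charge]
    rw [foldl_count_neighbors, zero_add, List.countP_eq_length_filter,
      ← List.toFinset_card_of_nodup ((List.nodup_finRange M).filter _)]
    congr 1
    ext w
    simp [mem_unexploredNeighbors, adjacent_ret]
  · have htable : 𝔊.TableCorrect x G K ∅ [] (fillTable G K [] fun _ _ _ => pure emptyEntry).ret :=
      tableCorrect_fillTable fun I _ g _ _ k _ _ => isBest_emptyEntry (Or.inl rfl)
    exact htable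

theorem time_initialState_le {c : CostModel} {Q G K : ℕ} (hG : 1 ≤ G) (hK : 1 ≤ K)
    (ha : ∀ i j, (c.charge (𝔊.adjacent i j)).time ≤ Q) :
    (𝔊.initialState c G K).time ≤ M * (M * (Q + 1) + 1) + G * K * 4 := by
  have h₁ := time_foldl_le (fun r v =>
    Timed.foldl (fun r u => do
      let b ← c.charge (𝔊.adjacent v u)
      pure (if b then Function.update r u (r u + 1) else r)) r (List.finRange M))
    (M * (Q + 1)) (List.finRange M) (fun r v _ => by
      refine (time_foldl_le _ Q _ (fun r u _ => ?_) _).trans_eq (by rw [List.length_finRange])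
      exact ha v u) fun _ => 0
  have h₂ := time_fillTable_le (N := N) (M := M) hG hK (B := [])
    (f := fun _ _ _ => pure emptyEntry) (t := 0) (fun _ _ _ _ => le_rfl)
  rw [List.length_finRange] at h₁
  simp only [List.length_nil, pow_zero, one_mul, zero_add] at h₂
  exact Nat.add_le_add h₁ h₂

/-! ### Optimality -/

theorem sum_listIndicator {n : ℕ} {R : Type*} [NonAssocSemiring R] (l : List (Fin n))
    (w : Fin n → R) :
    ∑ i, (((listIndicator l i : Fin 2) : ℕ) : R) * w i = ∑ i ∈ l.toFinset, w i := by
  rw [← Finset.sum_subset (Finset.subset_univ l.toFinset)]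
  · refine Finset.sum_congr rfl fun i hi => ?_
    simp [listIndicator, List.mem_toFinset.1 hi]
  · intro i _ hi
    rw [List.mem_toFinset] at hi
    simp [listIndicator, hi]

theorem sum_binary {n : ℕ} {R : Type*} [NonAssocSemiring R] (y : Fin n → Fin 2) (w : Fin n → R) :
    ∑ i, ((y i : ℕ) : R) * w i = ∑ i with y i = 1, w i := by
  rw [Finset.sum_filter]
  refine Finset.sum_congr rfl fun i _ => ?_
  rcases Fin.exists_fin_two.1 ⟨y i, rfl⟩ with h | h <;> simp [h]

theorem card_binary {n : ℕ} (y : Fin n → Fin 2) :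
    ∑ i, (y i : ℕ) = (Finset.univ.filter fun i => y i = 1).card := by
  simpa using sum_binary y fun _ => (1 : ℕ)

theorem card_listIndicator {n : ℕ} (l : List (Fin n)) :
    ∑ i, (listIndicator l i : ℕ) ≤ l.length := by
  have := sum_listIndicator l fun _ => (1 : ℕ)
  simp only [Nat.cast_id, mul_one, Finset.sum_const, smul_eq_mul] at this
  rw [this]
  exact List.toFinset_card_le l

theorem objective_listIndicator {l : List (Fin N)} (hl : l.Nodup) :
    objective x (listIndicator l) = (l.map fun i => x i ^ 2).sum := by
  rw [objective, sum_listIndicator, List.sum_toFinset _ hl]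

/-- Every feasible point is dominated by a competitor with the same elements. -/
theorem Feasible.exists_isCompetitor {G K : ℕ} {ω : Fin M → Fin 2} {y : Fin N → Fin 2}
    (h : 𝔊.Feasible G K ω y) :
    ∃ W, 𝔊.IsCompetitor Finset.univ (fun _ => 2) G K W (Finset.univ.filter fun i => y i = 1) := by
  classical
  set Y := Finset.univ.filter fun i => y i = 1
  set Ω := Finset.univ.filter fun j => ω j = 1
  have hcov : ∀ i ∈ Y, ∃ j ∈ Ω, i ∈ 𝔊.group j := by
    intro i hi
    have h₁ := h.covered i
    rw [(Finset.mem_filter.1 hi).2] at h₁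
    by_contra! hne
    have h₀ : (𝔊.biadjacency.mulVec fun j => (ω j : ℕ)) i = 0 := by
      rw [Matrix.mulVec, dotProduct]
      refine Finset.sum_eq_zero fun j _ => ?_
      rcases Fin.exists_fin_two.1 ⟨ω j, rfl⟩ with h' | h'
      · simp [h']
      · simp [biadjacency, hne j (Finset.mem_filter.2 ⟨Finset.mem_univ _, h'⟩)]
    rw [h₀] at h₁
    simp at h₁
  -- In a minimal subcover every group has a private element, since otherwise it could be dropped.
  obtain ⟨W, hWΩ, hW⟩ := exists_minimal_le_of_wellFoundedLT
    (fun W : Finset (Fin M) => ∀ i ∈ Y, ∃ j ∈ W, i ∈ 𝔊.group j) Ω hcov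
  refine ⟨W, Finset.subset_univ _, ?_, ?_, hW.prop, fun j hj => ?_, by simp, by simp⟩
  · exact (Finset.card_le_card hWΩ).trans ((card_binary ω).symm.trans_le h.groupSparse)
  · exact (card_binary y).symm.trans_le h.sparse
  · by_contra! hred
    have hle := hW.le_of_le (y := W.erase j) (fun i hi => ?_) (Finset.erase_subset _ _)
    · exact Finset.notMem_erase j W (hle hj)
    · obtain ⟨j', hj', hij', hne⟩ := hred i hi
      exact ⟨j', Finset.mem_erase.2 ⟨hne, hj'⟩, hij'⟩

theorem IsBest.isOptimal {G K : ℕ} {e : Entry N M}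
    (h : 𝔊.IsBest x Finset.univ (fun _ => 2) G K e) :
    𝔊.IsOptimal x G K (listIndicator e.groups) (listIndicator e.batches.flatten) ∧
      e.val = objective x (listIndicator e.batches.flatten) := by
  have hval : e.val = objective x (listIndicator e.batches.flatten) := by
    rw [objective_listIndicator h.elems_nodup, h.val_eq]
  refine ⟨⟨⟨fun i => ?_, ?_, ?_⟩, fun ω₁ y₁ h₁ => ?_⟩, hval⟩
  · by_cases hi : i ∈ e.batches.flatten
    · obtain ⟨j, hj, hij⟩ := h.elems_covered i hi
      refine le_trans ?_ (Finset.single_le_sum (fun _ _ => Nat.zero_le _) (Finset.mem_univ j))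
      simp [listIndicator, biadjacency, hi, hj, hij]
    · simp [listIndicator, hi]
  · exact (card_listIndicator _).trans h.elems_length_le
  · exact (card_listIndicator _).trans h.groups_length_le
  · obtain ⟨W, hW⟩ := h₁.exists_isCompetitor
    rw [← hval, objective, sum_binary]
    exact h.le_val W _ hW

/-- The parameter `Q` treats both cost models at once: it bounds an overlap test, and `2 * Q` bounds
a lookup of the heaviest elements. -/
theorem dynamicProgram_spec {c : CostModel} {Q G K : ℕ} (hM : 1 ≤ M) (hG : 1 ≤ G) (hK : 1 ≤ K)
    (hQ : 1 ≤ Q) (hac : 𝔊.groupGraph.IsAcyclic)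
    (ha : ∀ i j, (c.charge (𝔊.adjacent i j)).time ≤ Q)
    (hh : ∀ B : List (Fin M), B.length ≤ M → ∀ I v l,
      (c.charge (𝔊.heaviest x B I v l)).time ≤ 2 * Q) (root : Equiv.Perm (Fin M)) :
    (𝔊.IsOptimal x G K (listIndicator (𝔊.dynamicProgram c x G K root).ret.groups)
        (listIndicator (𝔊.dynamicProgram c x G K root).ret.elems) ∧
      (𝔊.dynamicProgram c x G K root).ret.val =
        objective x (listIndicator (𝔊.dynamicProgram c x G K root).ret.elems)) ∧
      (𝔊.dynamicProgram c x G K root).time ≤ 100 * (M ^ 2 * G * K ^ 2 * Q) := by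
  obtain ⟨horder, hall, htime⟩ := nodeOrder_spec hac ha root
  set order := (𝔊.nodeOrder c root).ret with ho
  set s₀ := (𝔊.initialState c G K).ret with hs₀
  set T := M * G * K ^ 2 * Q with hT
  obtain ⟨h₁, h₂⟩ := foldl_amortized_prefix (𝔊.explore c x G K)
    (fun pre s => 𝔊.StateCorrect x G K pre.toFinset s) (fun s => 30 * T * s.bdry.length)
    (73 * T) order [] (fun pre v suf heq s hs => by
      rw [List.nil_append] at heq
      have hnd := horder.nodup
      have hpre := horder.two_pow_le pre.length
      rw [heq] at hnd hpre
      rw [List.take_left] at hpre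
      have hv : v ∉ pre.toFinset := fun h =>
        (List.nodup_append'.1 hnd).2.2 (List.mem_toFinset.1 h) (by simp)
      have hins : (pre ++ [v]).toFinset = insert v pre.toFinset := by
        ext u
        simp
      rw [hins]
      exact explore_spec hG hK hQ ha hh hpre hv hs) s₀
    (stateCorrect_initialState c G K)
  set s := (Timed.foldl (𝔊.explore c x G K) s₀ order).ret with hs
  have huniv : ([] ++ order).toFinset = Finset.univ := by
    ext v
    simp [hall v]
  rw [huniv] at h₁
  -- At the end no node is unexplored, so the boundary is empty and the constant `2` is the only
  -- assignment left.
  have hbdry : s.bdry = [] := List.eq_nil_iff_forall_not_mem.2 fun j hj => by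
    obtain ⟨-, u, hu, -⟩ := 𝔊.mem_boundary.1 ((h₁.mem_bdry j).1 hj)
    exact hu (Finset.mem_univ u)
  have hbest := h₁.table (fun _ => 2) (by simp [mem_assignments, hbdry]) G le_rfl K le_rfl
  refine ⟨hbest.isOptimal, ?_⟩
  have htotal : (𝔊.dynamicProgram c x G K root).time = (𝔊.nodeOrder c root).time +
      ((𝔊.initialState c G K).time + ((Timed.foldl (𝔊.explore c x G K) s₀ order).time +
      (1 + ((readEntry s.table (fun _ => 2) G K).ret.groups.length +
        (readEntry s.table (fun _ => 2) G K).ret.batches.length +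
        (readEntry s.table (fun _ => 2) G K).ret.batches.flatten.length)))) := rfl
  have hinit := time_initialState_le hG hK ha
  have hbdry₀ : s₀.bdry = [] := rfl
  rw [hbdry₀, List.length_nil, Nat.mul_zero, Nat.add_zero] at h₂
  have hexp := (Nat.le_add_right _ _).trans h₂
  have hlen := length_le_of_nodup horder.nodup
  have hexp' := hexp.trans (Nat.mul_le_mul_right _ hlen)
  have hg := length_le_of_nodup hbest.groups_nodup
  have hb := hbest.batches_length
  have hk := hbest.elems_length_le
  have hT₁ : 1 ≤ T := by
    have : 0 < M * G * K ^ 2 * Q := by positivity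
    exact this
  have hMT : M ≤ M * T := Nat.le_mul_of_pos_right _ hT₁
  have hMQ : M * Q ≤ T := by
    have : M * Q * 1 ≤ M * Q * (G * K ^ 2) := Nat.mul_le_mul_left _ (by
      have : 0 < G * K ^ 2 := by positivity
      exact this)
    rw [hT]
    linarith
  have hGK : G * K ≤ T := by
    have : G * K * 1 ≤ G * K * (M * K * Q) := Nat.mul_le_mul_left _ (by
      have : 0 < M * K * Q := by positivity
      exact this)
    rw [hT]
    linarith
  have hK' : K ≤ G * K := Nat.le_mul_of_pos_left _ hG
  have hM' : M ≤ M * Q := Nat.le_mul_of_pos_right _ hQ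
  have hTM : T ≤ M * T := Nat.le_mul_of_pos_left _ hM
  have hMM : M * M ≤ M * T := Nat.mul_le_mul_left _ (hM'.trans hMQ)
  have hMMQ : M * (M * Q) ≤ M * T := Nat.mul_le_mul_left _ hMQ
  -- In multiples of `M * T`, the order costs at most `9`, the initial state `7`, the explorations
  -- `74` and the output `4`.
  have hgoal : 100 * (M ^ 2 * G * K ^ 2 * Q) = 100 * (M * T) := by rw [hT]; ring
  rw [htotal, hgoal, hb]
  have e₁ : M * (2 * M + 1) + (M * (Q + 2) + (M + 2)) * M =
      5 * (M * M) + 3 * M + M * (M * Q) := by ring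
  have e₂ : M * (M * (Q + 1) + 1) + G * K * 4 = M * (M * Q) + M * M + M + 4 * (G * K) := by ring
  have e₃ : M * (73 * T + 1) = 73 * (M * T) + M := by ring
  rw [e₁] at htime
  rw [e₂] at hinit
  rw [e₃] at hexp'
  linarith

theorem time_heaviest_le (B : List (Fin M)) (hB : B.length ≤ M) (I : Assignment M) (v : Fin M)
    (l : ℕ) : (𝔊.heaviest x B I v l).time ≤ 2 * (M + N + 1) ^ 2 := by
  have h₁ : (𝔊.cleaned B I v).time ≤ N * (B.length + 2) := by
    exact (time_filter_le _ (B.length + 1) _ fun i _ => le_rfl).trans_eq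
      (by rw [List.length_finRange])
  have h₂ : (𝔊.cleaned B I v).ret.length ≤ N := by
    simpa using (nodup_cleaned (𝔊 := 𝔊) (B := B) (I := I) (v := v)).length_le_card
  have h₃ := time_sortDesc_le (fun i => x i ^ 2) (𝔊.cleaned B I v).ret
  have h₄ : ((sortDesc (fun i => x i ^ 2) (𝔊.cleaned B I v).ret).ret.take l).length ≤ N := by
    rw [List.length_take, (sortDesc_perm _ _).length_eq]
    exact (min_le_right _ _).trans h₂
  have h₅ : N * (B.length + 2) ≤ N * (M + 2) := Nat.mul_le_mul_left _ (by omega)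
  have h₆ := Nat.mul_le_mul h₂ h₂
  simp only [heaviest, time_bind, time_tick, time_pure]
  nlinarith

end GroupStructure

/-! ### The main theorem -/

theorem theorem1 :
    ∃ C : ℕ, ∀ (N M G K : ℕ) (𝔊 : GroupStructure N M) (x : Fin N → ℝ) (root : Equiv.Perm (Fin M)),
      1 ≤ M → 1 ≤ G → 1 ≤ K → 𝔊.LooplessPairwiseOverlapping →
      -- the node picking order enumerates the nodes, with few boundary nodes at every step
      (∀ c : CostModel,
        (𝔊.nodeOrder c root).ret.Nodup ∧ (∀ v, v ∈ (𝔊.nodeOrder c root).ret) ∧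
        ∀ m ≤ M, ((𝔊.boundary ((𝔊.nodeOrder c root).ret.take m).toFinset).card : ℝ) ≤
          Real.logb 2 M + 1) ∧
      -- the dynamic program returns an optimal solution and its value
      (∀ c : CostModel,
        𝔊.IsOptimal x G K (listIndicator (𝔊.dynamicProgram c x G K root).ret.groups)
          (listIndicator (𝔊.dynamicProgram c x G K root).ret.elems) ∧
        (𝔊.dynamicProgram c x G K root).ret.val =
          GroupStructure.objective x (listIndicator (𝔊.dynamicProgram c x G K root).ret.elems)) ∧
      -- its running time
      (𝔊.dynamicProgram .unit x G K root).time ≤ C * (M ^ 2 * G * K ^ 2) ∧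
      (𝔊.dynamicProgram .elementary x G K root).time ≤
        C * (M ^ 2 * G * K ^ 2) * (M + N + 1) ^ 2 := by
  refine ⟨100, fun N M G K 𝔊 x root hM hG hK h𝔊 => ?_⟩
  have hadj : ∀ i j, (CostModel.elementary.charge (𝔊.adjacent i j)).time ≤ (M + N + 1) ^ 2 := by
    intro i j
    simp only [CostModel.charge, GroupStructure.adjacent, Timed.time_bind, Timed.time_tick,
      Timed.time_pure]
    nlinarith
  -- The unit model takes `Q = 1`, the elementary one `Q = (M + N + 1) ^ 2`.
  have hunit := 𝔊.dynamicProgram_spec (c := .unit) (x := x) hM hG hK le_rfl h𝔊.2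
    (fun _ _ => le_rfl) (fun _ _ _ _ _ => one_le_two) root
  have helem := 𝔊.dynamicProgram_spec (c := .elementary) (x := x) hM hG hK
    (Nat.one_le_pow _ _ (Nat.succ_pos _)) h𝔊.2 hadj
    (fun B hB I v l => GroupStructure.time_heaviest_le B hB I v l) root
  refine ⟨fun c => ?_, fun c => ?_, by simpa using hunit.2, by simpa [mul_assoc] using helem.2⟩
  · obtain ⟨horder, hall⟩ : 𝔊.ExploresTrees (𝔊.nodeOrder c root).ret ∧
        ∀ v, v ∈ (𝔊.nodeOrder c root).ret := by
      cases c
      · exact (GroupStructure.nodeOrder_spec (a := 1) h𝔊.2 (fun _ _ => le_rfl) root).imp_right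
          And.left
      · exact (GroupStructure.nodeOrder_spec h𝔊.2 hadj root).imp_right And.left
    refine ⟨horder.nodup, hall, fun m _ => ?_⟩
    set b := (𝔊.boundary ((𝔊.nodeOrder c root).ret.take m).toFinset).card
    -- Since `1 ≤ M`, the bound `M + 1` is at most `2 * M`; the factor `2` becomes the summand `1`
    -- under the logarithm.
    have hpow : (2 : ℝ) ^ b ≤ M * 2 := by
      have h : 2 ^ b ≤ M + 1 := horder.two_pow_le m
      have h' : 2 ^ b ≤ M * 2 := by omega
      exact_mod_cast h'
    have hM0 : (0 : ℝ) < M := by exact_mod_cast hM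
    have hlog := Real.logb_le_logb_of_le one_lt_two (by positivity) hpow
    rw [Real.logb_mul hM0.ne' two_ne_zero, Real.logb_self_eq_one one_lt_two,
      ← Real.rpow_natCast, Real.logb_rpow two_pos (by norm_num)] at hlog
    exact hlog
  · cases c
    · exact hunit.1
    · exact helem.1
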